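/- **Conventions.** Let $M$ be an $n$-dimensional smooth Hausdorff manifold and $L$ an $n$-dimensional real Lie algebra of smooth vector fields on $M$ with $\{X(x): X\in L\}=T_xM$ for every $x\in M$. Let $\Gamma\in L$, and put $$L_{\Gamma,0}=L,\qquad L_{\Gamma,l}=\langle\Gamma\rangle+[L_{\Gamma,l-1},L_{\Gamma,l-1}]\quad(l\ge 1).$$ $(M,L,\Gamma)$ is *Lie integrable of order $r=k+1$* if $k\ge 0$ is the smallest integer for which $L_{\Gamma,k}$ is Abelian. Let $L_{\Gamma,l}^0\subset L_{\Gamma,l-1}^*$ denote the annihilator of $L_{\Gamma,l}$ and let $$\Xi=L_{\Gamma,1}^0\oplus\cdots\oplus L_{\Gamma,k}^0\oplus L_{\Gamma,k}^*$$ be the formal direct sum. For $\xi\in\Xi$ let $\xi(\Gamma)$ be the sum of the values on $\Gamma$ of the components of $\xi$ (defined since $\Gamma$ lies in all $L_{\Gamma,l}$). Given a set $B$ of real functions on open subsets of the spaces $\mathbb R^m$, a function is *known from $B$* if it is obtained from functions in $B$, constants and coordinates by sums, products, inverses of nowhere vanishing functions, restriction to smaller open sets, substitution, partial differentiation, and elimination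 (passing to a smooth solution $y=g(x)$ of a system $F(x,y)=0$ of known equations, as many as there are unknowns $y$, with $\partial F/\partial y$ invertible along the solution). A function $F(x)=\int_{a(x)}^{b(x)}f(x,s)\,ds$, $x\in\mathbb R^m$, on an open set, with $f,a,b$ known from $B$, is obtained from $B$ by *one quadrature*. A sequence of *$r$ quadratures from $B$* is a sequence $F_1,\dots,F_r$ such that each $F_j$ is obtained by one quadrature from $B\cup\{F_1,\dots,F_{j-1}\}$. **Theorem.** If $(M,L,\Gamma)$ is Lie integrable of order $r=k+1$, then the integral curves of $\Gamma$ can be obtained locally, in any chart, by $r$ quadratures. Precisely: $\dim\Xi=n$, and for every smooth chart $\varphi$ of $M$ and every point $p$ of its domain, if $B$ is the set of components in $\varphi$ of the vector fields of $L$, there are a sequence $F_1,\dots,F_r$ of $r$ quadratures from $B$, an open neighbourhood $U$ of $p$ in the domain of $\varphi$, and functions $Q_\xi$ ($\xi\in\Xi$), depending linearly on $\xi$ and smooth on $U$, such that: 1. for $1\le l\le k$ and $\zeta\in L_{\Gamma,l}^0$, the function $Q_\zeta$, expressed in the chart $\varphi$, is known from $B\cup\{F_1,\dots,F_l\}$,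 and $XQ_\zeta=\zeta(X)$ on $U$ for all $X\in L_{\Gamma,l-1}$; for $\zeta\in L_{\Gamma,k}^*$, $XQ_\zeta=\zeta(X)$ on $U$ for all $X\in L_{\Gamma,k}$; and for all $\xi\in\Xi$ the function $Q_\xi$, expressed in $\varphi$, is known from $B\cup\{F_1,\dots,F_r\}$; 2. $\Gamma Q_\xi=\xi(\Gamma)$, a constant, on $U$ for every $\xi\in\Xi$; 3. for every basis $\xi_1,\dots,\xi_n$ of $\Xi$ the functions $Q_{\xi_1},\dots,Q_{\xi_n}$ are functionally independent on $U$ (their differentials are linearly independent at each point of $U$), and they are the coordinates of a smooth chart of $M$ with domain $U$; 4. for every integral curve $\gamma$ of $\Gamma$ with values in $U$, defined on an interval $I$, $Q_\xi(\gamma(t))=Q_\xi(\gamma(t_0))+\xi(\Gamma)(t-t_0)$ for all $t_0,t\in I$ and $\xi\in\Xi$; 5. there are an open neighbourhood $V\subset U$ of $p$, an $\varepsilon>0$ and a local flow $\Phi$ of $\Gamma$, with $\Phi_t(x)\in U$ for $x\in V$, $|t|<\varepsilon$, such that the components of $\Phi_t(x)$ in the chart $\varphi$, as functions of the coordinates of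 $x$ and of $t$, are known from $B\cup\{F_1,\dots,F_r\}$. -/

import Mathlib

open Set
open scoped Manifold ContDiff Topology

noncomputable section

/-! ### Functions obtained by quadratures -/

/-- A real function of finitely many real variables, considered on a domain `dom`
(its values outside `dom` are irrelevant). -/
structure LocalFun where
  dim : ℕ
  dom : Set (Fin dim → ℝ)
  toFun : (Fin dim → ℝ) → ℝ

/-- `IsKnown B U f`: on the open set `U`, the function `f` can be obtained from the functions
in `B` by algebraic operations, substitution, partial differentiation and elimination
(solving implicit equations with invertible Jacobian), without any integration. -/
inductive IsKnown (B : Set LocalFun) : {m : ℕ} → Set (Fin m → ℝ) → ((Fin m → ℝ) → ℝ) → Prop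
  /-- the given functions -/
  | base (g : LocalFun) (hg : g ∈ B) : IsKnown B g.dom g.toFun
  /-- constants -/
  | const {m : ℕ} (U : Set (Fin m → ℝ)) (hU : IsOpen U) (c : ℝ) : IsKnown B U (fun _ => c)
  /-- the independent variables -/
  | coord {m : ℕ} (U : Set (Fin m → ℝ)) (hU : IsOpen U) (i : Fin m) : IsKnown B U (fun x => x i)
  | add {m : ℕ} {U : Set (Fin m → ℝ)} {f g : (Fin m → ℝ) → ℝ} :
      IsKnown B U f → IsKnown B U g → IsKnown B U (fun x => f x + g x)
  | mul {m : ℕ} {U : Set (Fin m → ℝ)} {f g : (Fin m → ℝ) → ℝ} :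
      IsKnown B U f → IsKnown B U g → IsKnown B U (fun x => f x * g x)
  | inv {m : ℕ} {U : Set (Fin m → ℝ)} {f : (Fin m → ℝ) → ℝ} :
      IsKnown B U f → (∀ x ∈ U, f x ≠ 0) → IsKnown B U (fun x => (f x)⁻¹)
  /-- restriction to a smaller open set (values off the domain are irrelevant) -/
  | restrict {m : ℕ} {U V : Set (Fin m → ℝ)} {f g : (Fin m → ℝ) → ℝ} :
      IsKnown B U f → IsOpen V → V ⊆ U → EqOn f g V → IsKnown B V g
  /-- substitution -/
  | comp {m d : ℕ} {U : Set (Fin d → ℝ)} {V : Set (Fin m → ℝ)} {f : (Fin d → ℝ) → ℝ}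
      {g : Fin d → (Fin m → ℝ) → ℝ} :
      IsKnown B U f → IsOpen V → (∀ i, IsKnown B V (g i)) →
      (∀ x ∈ V, (fun i => g i x) ∈ U) → IsKnown B V (fun x => f (fun i => g i x))
  /-- partial differentiation -/
  | partialDeriv {m : ℕ} {U : Set (Fin m → ℝ)} {f : (Fin m → ℝ) → ℝ} (i : Fin m) :
      IsKnown B U f → IsKnown B U (fun x => fderiv ℝ f x (Pi.single i 1))
  /-- elimination: a smooth solution `y = g x` of the equations `F (x, y) = 0`, where
  the Jacobian matrix of `F` with respect to `y` is invertible along the solution -/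
  | elim {m d : ℕ} {U : Set (Fin (m + d) → ℝ)} {V : Set (Fin m → ℝ)}
      {F : Fin d → (Fin (m + d) → ℝ) → ℝ} {g : (Fin m → ℝ) → (Fin d → ℝ)} :
      (∀ i, IsKnown B U (F i)) → IsOpen V → ContDiffOn ℝ ∞ g V →
      (∀ x ∈ V, Fin.append x (g x) ∈ U) →
      (∀ x ∈ V, ∀ i, F i (Fin.append x (g x)) = 0) →
      (∀ x ∈ V, IsUnit (Matrix.of fun i j : Fin d =>
        fderiv ℝ (F i) (Fin.append x (g x)) (Pi.single (Fin.natAdd m j) 1)).det) →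
      ∀ i, IsKnown B V (fun x => g x i)

/-- `F` arises from the functions in `B` by one quadrature: it is a single definite integral
`F x = ∫ s in a x..b x, f (x, s)` of a known function depending on the finitely many
parameters `x`, with known limits of integration. -/
def IsQuadrature (B : Set LocalFun) (F : LocalFun) : Prop :=
  IsOpen F.dom ∧
  ∃ (W : Set (Fin (F.dim + 1) → ℝ)) (f : (Fin (F.dim + 1) → ℝ) → ℝ) (a b : (Fin F.dim → ℝ) → ℝ),
    IsKnown B W f ∧ IsKnown B F.dom a ∧ IsKnown B F.dom b ∧
    ∀ x ∈ F.dom,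
      (∀ s ∈ uIcc (a x) (b x), (Fin.snoc x s : Fin (F.dim + 1) → ℝ) ∈ W) ∧
      F.toFun x = ∫ s in (a x)..(b x), f (Fin.snoc x s)

/-- `F 0, …, F (r - 1)` is a sequence of `r` successive quadratures starting from `B`: each
integral is performed on functions known from `B` and the preceding integrals. -/
def IsQuadratureSequence (B : Set LocalFun) {r : ℕ} (F : Fin r → LocalFun) : Prop :=
  ∀ j : Fin r, IsQuadrature (B ∪ F '' Iio j) (F j)

/-! ### Lie algebras of vector fields -/

/-- (Not necessarily smooth) vector fields on `M`. -/
abbrev VField (n : ℕ) (M : Type*) [TopologicalSpace M] [ChartedSpace (EuclideanSpace ℝ (Fin n)) M] :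
    Type _ :=
  (x : M) → TangentSpace (𝓡 n) x

section Manifold

variable {n : ℕ} {M : Type*} [TopologicalSpace M] [ChartedSpace (EuclideanSpace ℝ (Fin n)) M]

/-- `L` is an `n`-dimensional real Lie algebra of smooth vector fields on the `n`-dimensional
manifold `M` which spans the tangent space at every point. -/
structure IsSpanningLieAlgebra [IsManifold (𝓡 n) ∞ M] (L : Submodule ℝ (VField n M)) : Prop where
  smooth : ∀ X ∈ L, ContMDiff (𝓡 n) (𝓡 n).tangent ∞
    (fun x => (⟨x, X x⟩ : TangentBundle (𝓡 n) M))
  bracket_mem : ∀ X ∈ L, ∀ Y ∈ L, VectorField.mlieBracket (𝓡 n) X Y ∈ L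
  finite : Module.Finite ℝ L
  finrank_eq : Module.finrank ℝ L = n
  spans : ∀ (x : M) (v : TangentSpace (𝓡 n) x), ∃ X ∈ L, X x = v

/-- The series `L_{Γ,0} = L`, `L_{Γ,k+1} = ⟨Γ⟩ + [L_{Γ,k}, L_{Γ,k}]`. -/
def lieSeries (L : Submodule ℝ (VField n M)) (Γ : VField n M) : ℕ → Submodule ℝ (VField n M)
  | 0 => L
  | k + 1 => Submodule.span ℝ {Γ} ⊔ Submodule.span ℝ
      {Z | ∃ X ∈ lieSeries L Γ k, ∃ Y ∈ lieSeries L Γ k, Z = VectorField.mlieBracket (𝓡 n) X Y}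

theorem mem_lieSeries {L : Submodule ℝ (VField n M)} {Γ : VField n M} (hΓ : Γ ∈ L) (k : ℕ) :
    Γ ∈ lieSeries L Γ k := by
  cases k with
  | zero => exact hΓ
  | succ k => exact Submodule.mem_sup_left (Submodule.mem_span_singleton_self Γ)

/-- A space of vector fields is Abelian if all brackets of its elements vanish. -/
def IsAbelianSpace (A : Submodule ℝ (VField n M)) : Prop :=
  ∀ X ∈ A, ∀ Y ∈ A, VectorField.mlieBracket (𝓡 n) X Y = 0

/-- `(M, L, Γ)` is Lie integrable of order `r = k + 1`: `k` is the smallest non-negative integer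
such that `L_{Γ,k}` is Abelian. -/
def IsLieIntegrableOfOrder (L : Submodule ℝ (VField n M)) (Γ : VField n M) (r : ℕ) : Prop :=
  ∃ k, r = k + 1 ∧ IsAbelianSpace (lieSeries L Γ k) ∧
    ∀ j < k, ¬ IsAbelianSpace (lieSeries L Γ j)

/-- The annihilator of `L_{Γ,l+1}` in the dual space of `L_{Γ,l}`. -/
def stageAnnihilator (L : Submodule ℝ (VField n M)) (Γ : VField n M) (l : ℕ) :
    Submodule ℝ (Module.Dual ℝ (lieSeries L Γ l)) :=
  ((lieSeries L Γ (l + 1)).comap (lieSeries L Γ l).subtype).dualAnnihilator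

/-- The formal direct sum `Ξ = L_{Γ,1}⁰ ⊕ ⋯ ⊕ L_{Γ,k}⁰ ⊕ L_{Γ,k}^*`, where `L_{Γ,l+1}⁰` is the
annihilator of `L_{Γ,l+1}` in `L_{Γ,l}^*`. -/
abbrev FormalSum (L : Submodule ℝ (VField n M)) (Γ : VField n M) (k : ℕ) : Type _ :=
  ((l : Fin k) → stageAnnihilator L Γ l) × Module.Dual ℝ (lieSeries L Γ k)

/-- The inclusion of the summand with index `l < k` in `Ξ`. -/
def FormalSum.stage (L : Submodule ℝ (VField n M)) (Γ : VField n M) (k : ℕ) (l : Fin k) :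
    stageAnnihilator L Γ l →ₗ[ℝ] FormalSum L Γ k :=
  LinearMap.inl ℝ _ _ ∘ₗ LinearMap.single ℝ (fun l : Fin k => stageAnnihilator L Γ l) l

/-- The inclusion of the last summand `L_{Γ,k}^*` in `Ξ`. -/
def FormalSum.last (L : Submodule ℝ (VField n M)) (Γ : VField n M) (k : ℕ) :
    Module.Dual ℝ (lieSeries L Γ k) →ₗ[ℝ] FormalSum L Γ k :=
  LinearMap.inr ℝ _ _

/-- The value `ξ(Γ)`, defined for every `ξ ∈ Ξ` because `Γ` lies in all the spaces `L_{Γ,l}`. -/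
def FormalSum.evalGamma {L : Submodule ℝ (VField n M)} {Γ : VField n M} (hΓ : Γ ∈ L) {k : ℕ}
    (ξ : FormalSum L Γ k) : ℝ :=
  (∑ l : Fin k, (ξ.1 l : Module.Dual ℝ (lieSeries L Γ l)) ⟨Γ, mem_lieSeries hΓ l⟩)
    + ξ.2 ⟨Γ, mem_lieSeries hΓ k⟩

/-- The differential at `x` of a function `f` on `M`. -/
def differentialAt (f : M → ℝ) (x : M) : TangentSpace (𝓡 n) x →L[ℝ] ℝ :=
  mfderiv (𝓡 n) 𝓘(ℝ, ℝ) f x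

/-- The derivative `X f` of a function `f` in the direction of a vector field `X`, at `x`. -/
def VField.deriv (X : VField n M) (f : M → ℝ) (x : M) : ℝ :=
  differentialAt f x (X x)

/-! ### Quadratures in a chart -/

/-- The components at `x` of the vector field `X` in the chart `φ`, as a vector of `ℝⁿ`. -/
def componentAt (φ : OpenPartialHomeomorph M (EuclideanSpace ℝ (Fin n))) (X : VField n M)
    (x : M) : EuclideanSpace ℝ (Fin n) :=
  mfderiv (𝓡 n) (𝓡 n) φ x (X x)

/-- The functions given at the outset: the components, in the chart `φ`, of the vector fields
in `L`. -/
def chartComponents (L : Submodule ℝ (VField n M))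
    (φ : OpenPartialHomeomorph M (EuclideanSpace ℝ (Fin n))) : Set LocalFun :=
  {g | ∃ X ∈ L, ∃ i : Fin n, g = ⟨n, {y | WithLp.toLp 2 y ∈ φ.target}, fun y =>
    componentAt φ X (φ.symm (WithLp.toLp 2 y)) i⟩}

/-- In the chart `φ`, the function `f` on `U ⊆ M` is known from `B`. -/
def IsKnownInChart (B : Set LocalFun) (φ : OpenPartialHomeomorph M (EuclideanSpace ℝ (Fin n)))
    (U : Set M) (f : M → ℝ) : Prop :=
  IsKnown B {y : Fin n → ℝ | WithLp.toLp 2 y ∈ φ.target ∧ φ.symm (WithLp.toLp 2 y) ∈ U}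
    (fun y => f (φ.symm (WithLp.toLp 2 y)))

/-- `Φ` is a local flow of `Γ` on `V`, for times in `(-ε, ε)`, with values in `U`. -/
def IsLocalFlow (Γ : VField n M) (U V : Set M) (ε : ℝ) (Φ : ℝ → M → M) : Prop :=
  ∀ x ∈ V, Φ 0 x = x ∧ IsMIntegralCurveOn (fun t => Φ t x) Γ (Ioo (-ε) ε) ∧
    ∀ t ∈ Ioo (-ε) ε, Φ t x ∈ U

/-- In the chart `φ`, the components of `Φ t x`, as functions of the coordinates of `x ∈ V` (the
first `n` variables) and of the time `t ∈ (-ε, ε)` (the last variable), are known from `B`. -/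
def FlowIsKnownInChart (B : Set LocalFun)
    (φ : OpenPartialHomeomorph M (EuclideanSpace ℝ (Fin n))) (V : Set M) (ε : ℝ)
    (Φ : ℝ → M → M) : Prop :=
  ∀ i : Fin n, IsKnown B
    {z : Fin (n + 1) → ℝ | z (Fin.last n) ∈ Ioo (-ε) ε ∧
      WithLp.toLp 2 (fun j : Fin n => z j.castSucc) ∈ φ.target ∧
      φ.symm (WithLp.toLp 2 (fun j : Fin n => z j.castSucc)) ∈ V}
    (fun z => φ (Φ (z (Fin.last n)) (φ.symm (WithLp.toLp 2 (fun j : Fin n => z j.castSucc)))) i)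

end Manifold

end

/-! Take a basis of `L` adapted to the series, and let the stage of a basis field be the last `l ≤
k` for which it lies in $L_{\Gamma,l}$. The dual coframe $\omega^i$ is rational in the chart
components, and on fields of `L` its values are constants, so that $d\omega^i(X,Y)=-\omega^i([X,Y])$
for $X,Y\in L$. If `i` has stage `l` and $X,Y\in L_{\Gamma,l}$, the bracket lies in
$L_{\Gamma,l+1}$, whose elements have no `i`-th coordinate, or it vanishes when `l = k`. Hence
$\omega^i$ is closed along the distribution spanned by $L_{\Gamma,l}$
(`StagedFrame.fderiv_coframe_symm`).

The leaves of that distribution are joint level sets of the functions $Q_j$ of lower stages. On them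
the Poincaré lemma with parameters (`fderiv_leafPrimitive`) gives a primitive $Q_i$ of $\omega^i$.
All primitives of one stage cost a single quadrature: integrate $\sum c_i\omega^i$ with the $c_i$ as
parameters, then substitute unit vectors for `c` (`exists_quadrature_leafPrimitive`). The induction
step is `StagedFrame.IsIntegrals.exists_next`; the `k + 1` stages need `k + 1` quadratures.

Since $dQ_i=\omega^i$ modulo coframe elements of lower stage, the $Q_i$ are local coordinates. As
$\Gamma$ lies in every $L_{\Gamma,l}$, each $\Gamma Q_i$ is constant, so the flow is a translation
in these coordinates; elimination brings it back to the chart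
(`isLocalFlow_and_known_of_rectified`). Evaluation on the adapted basis identifies $\Xi$ with
$\mathbb R^n$ (`SeriesBasis.coeffEquiv`), and $Q_\xi=\sum\xi_iQ_i$. -/

/-! ### Calculus of known functions -/

namespace IsKnown

variable {B B' : Set LocalFun} {m d : ℕ} {U V : Set (Fin m → ℝ)} {f g : (Fin m → ℝ) → ℝ}

theorem mono (hB : B ⊆ B') (h : IsKnown B U f) : IsKnown B' U f := by
  induction h with
  | base g hg => exact .base g (hB hg)
  | const U hU c => exact .const U hU c
  | coord U hU i => exact .coord U hU i
  | add _ _ h₁ h₂ => exact .add h₁ h₂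
  | mul _ _ h₁ h₂ => exact .mul h₁ h₂
  | inv _ h0 h => exact .inv h h0
  | restrict _ hV hVU hfg h => exact .restrict h hV hVU hfg
  | comp _ hV _ hVU hf hg => exact .comp hf hV hg hVU
  | partialDeriv i _ h => exact .partialDeriv i h
  | elim _ hV hg hU h0 hdet i hF => exact .elim hF hV hg hU h0 hdet i

/-- Every construction preserves smoothness; elimination carries it as a requirement on the
solution. This later yields smoothness of the coframe from the fact that it is known. -/
theorem isOpen_and_contDiffOn
    (hB : ∀ g ∈ B, IsOpen g.dom ∧ ContDiffOn ℝ ∞ g.toFun g.dom) (h : IsKnown B U f) :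
    IsOpen U ∧ ContDiffOn ℝ ∞ f U := by
  induction h with
  | base g hg => exact hB g hg
  | const U hU c => exact ⟨hU, contDiffOn_const⟩
  | coord U hU i => exact ⟨hU, (contDiff_apply ℝ ℝ i).contDiffOn⟩
  | add _ _ h₁ h₂ => exact ⟨h₁.1, h₁.2.add h₂.2⟩
  | mul _ _ h₁ h₂ => exact ⟨h₁.1, h₁.2.mul h₂.2⟩
  | inv _ h0 h => exact ⟨h.1, h.2.inv h0⟩
  | restrict _ hV hVU hfg h => exact ⟨hV, (h.2.mono hVU).congr fun x hx => (hfg hx).symm⟩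
  | comp _ hV _ hVU hf hg =>
    exact ⟨hV, hf.2.comp (contDiffOn_pi.2 fun i => (hg i).2) hVU⟩
  | partialDeriv i _ h =>
    exact ⟨h.1, (h.2.fderiv_of_isOpen h.1 (by simp)).clm_apply contDiffOn_const⟩
  | elim _ hV hg hU h0 hdet i hF => exact ⟨hV, contDiffOn_pi.1 hg i⟩

theorem congr (h : IsKnown B U f) (hU : IsOpen U) (hfg : EqOn f g U) : IsKnown B U g :=
  h.restrict hU subset_rfl hfg

theorem mono_set (h : IsKnown B U f) (hV : IsOpen V) (hVU : V ⊆ U) : IsKnown B V f :=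
  h.restrict hV hVU fun _ _ => rfl

theorem sum {ι : Type*} (hU : IsOpen U) (s : Finset ι) {f : ι → (Fin m → ℝ) → ℝ}
    (h : ∀ i ∈ s, IsKnown B U (f i)) : IsKnown B U (fun x => ∑ i ∈ s, f i x) := by
  classical
  induction s using Finset.induction_on with
  | empty => simpa using IsKnown.const U hU 0
  | insert a s ha ih =>
    simp only [Finset.sum_insert ha]
    exact (h a (by simp)).add (ih fun i hi => h i (by simp [hi]))

theorem prod {ι : Type*} (hU : IsOpen U) (s : Finset ι) {f : ι → (Fin m → ℝ) → ℝ}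
    (h : ∀ i ∈ s, IsKnown B U (f i)) : IsKnown B U (fun x => ∏ i ∈ s, f i x) := by
  classical
  induction s using Finset.induction_on with
  | empty => simpa using IsKnown.const U hU 1
  | insert a s ha ih =>
    simp only [Finset.prod_insert ha]
    exact (h a (by simp)).mul (ih fun i hi => h i (by simp [hi]))

theorem const_mul (hU : IsOpen U) (c : ℝ) (h : IsKnown B U f) :
    IsKnown B U (fun x => c * f x) :=
  (IsKnown.const U hU c).mul h

theorem sub (hU : IsOpen U) (hf : IsKnown B U f) (hg : IsKnown B U g) :
    IsKnown B U (fun x => f x - g x) :=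
  (hf.add (hg.const_mul hU (-1))).congr hU fun x _ => by ring

theorem det (hU : IsOpen U) {A : (Fin m → ℝ) → Matrix (Fin d) (Fin d) ℝ}
    (h : ∀ i j, IsKnown B U (fun x => A x i j)) : IsKnown B U (fun x => (A x).det) := by
  simp only [Matrix.det_apply']
  exact .sum hU _ fun σ _ => (IsKnown.prod hU _ fun i _ => h _ _).const_mul hU _

/-- Cramer's rule: the only division is by the determinant, and an adjugate entry is the determinant
of the matrix with one row replaced by a constant unit vector. -/
theorem matrix_inv (hU : IsOpen U) {A : (Fin m → ℝ) → Matrix (Fin d) (Fin d) ℝ}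
    (h : ∀ i j, IsKnown B U (fun x => A x i j)) (hA : ∀ x ∈ U, (A x).det ≠ 0) (i j : Fin d) :
    IsKnown B U (fun x => (A x)⁻¹ i j) := by
  simp only [Matrix.inv_def, Ring.inverse_eq_inv', Matrix.smul_apply, smul_eq_mul,
    Matrix.adjugate_apply]
  refine ((IsKnown.det hU h).inv hA).mul (IsKnown.det hU fun a b => ?_)
  by_cases ha : a = j
  · subst ha
    simpa using IsKnown.const U hU _
  · simpa [Matrix.updateRow_ne ha] using h a b

/-- The components of the inverse of a known local diffeomorphism are known. -/
theorem localInverse {n : ℕ} (e : OpenPartialHomeomorph (Fin n → ℝ) (Fin n → ℝ))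
    (he : ∀ i, IsKnown B e.source (fun y => e y i))
    (hsmooth : ContDiffOn ℝ ∞ e e.source) (hsymm : ContDiffOn ℝ ∞ e.symm e.target)
    (hdet : ∀ y ∈ e.source,
      IsUnit (Matrix.of fun i j => fderiv ℝ e y (Pi.single j 1) i).det) (i : Fin n) :
    IsKnown B e.target (fun w => e.symm w i) := by
  let π : (Fin (n + n) → ℝ) →L[ℝ] (Fin n → ℝ) :=
    ContinuousLinearMap.pi fun j => ContinuousLinearMap.proj (Fin.natAdd n j)
  have hπ : ∀ w y : Fin n → ℝ, π (Fin.append w y) = y := fun w y => by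
    ext j; exact Fin.append_right w y j
  have hU : IsOpen (π ⁻¹' e.source) := e.open_source.preimage π.continuous
  -- The inverse solves `e y - w = 0` for `y`, with `w` in the first `n` slots and `y` in the last
  -- `n`. The Jacobian in `y` is that of `e`, because `w` does not depend on `y`.
  refine IsKnown.elim (B := B) (U := π ⁻¹' e.source)
    (F := fun i z => e (π z) i - z (Fin.castAdd n i)) (fun i => ?_) e.open_target hsymm
    (fun w hw => ?_) (fun w hw i => ?_) (fun w hw => ?_) i
  · refine IsKnown.sub hU ((he i).comp (g := fun j z => z (Fin.natAdd n j)) hU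
      (fun j => .coord _ hU _) fun z hz => hz) (.coord _ hU _)
  · simpa only [mem_preimage, hπ] using e.map_target hw
  · simp [hπ, e.right_inv hw]
  · have hs := e.map_target hw
    convert hdet _ hs using 3
    ext i j
    have h1 : HasFDerivAt e (fderiv ℝ e (e.symm w)) (π (Fin.append w (e.symm w))) := by
      rw [hπ]
      exact ((hsmooth.contDiffAt (e.open_source.mem_nhds hs)).differentiableAt
        (by simp)).hasFDerivAt
    have h2 := (hasFDerivAt_pi'.1 (h1.comp _ π.hasFDerivAt) i).sub
      (ContinuousLinearMap.proj (R := ℝ) (φ := fun _ : Fin (n + n) => ℝ)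
        (Fin.castAdd n i)).hasFDerivAt
    have h3 := h2.fderiv
    have h4 : π (Pi.single (Fin.natAdd n j) 1) = Pi.single j 1 := by
      ext a
      change (Pi.single (Fin.natAdd n j) (1 : ℝ) : Fin (n + n) → ℝ) (Fin.natAdd n a) = _
      simp only [Pi.single_apply, Fin.natAdd_inj]
    have h5 : Fin.castAdd n i ≠ Fin.natAdd n j := by
      intro h; have := congrArg Fin.val h; simp at this; omega
    refine (DFunLike.congr_fun h3 (Pi.single (Fin.natAdd n j) 1)).trans ?_
    change fderiv ℝ e (e.symm w) (π (Pi.single (Fin.natAdd n j) 1)) i -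
      (Pi.single (Fin.natAdd n j) (1 : ℝ) : Fin (n + n) → ℝ) (Fin.castAdd n i) = _
    rw [h4, Pi.single_eq_of_ne h5, sub_zero]

end IsKnown

/-! ### Smooth dependence of integrals on parameters -/

section ParametricIntegral

variable {E F : Type} [NormedAddCommGroup E] [NormedSpace ℝ E] [FiniteDimensional ℝ E]
  [NormedAddCommGroup F] [NormedSpace ℝ F]

theorem ContinuousOn.uIcc_section {X Y : Type*} [TopologicalSpace X] [TopologicalSpace Y]
    {O : Set (X × ℝ)} {f : X × ℝ → Y} (hf : ContinuousOn f O) {a b : ℝ} {x : X}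
    (hx : ∀ t ∈ uIcc a b, (x, t) ∈ O) : ContinuousOn (fun t => f (x, t)) (uIcc a b) :=
  hf.comp (by fun_prop) hx

/-- Differentiation under the integral sign for a `C¹` integrand on a compact interval. -/
theorem hasFDerivAt_intervalIntegral_of_contDiffOn {O : Set (E × ℝ)} (hO : IsOpen O)
    {f : E × ℝ → F} (hf : ContDiffOn ℝ 1 f O) {D : Set E} (hD : IsOpen D) {a b : ℝ}
    (hDO : ∀ w ∈ D, ∀ t ∈ uIcc a b, (w, t) ∈ O) {w : E} (hw : w ∈ D) :
    HasFDerivAt (fun x => ∫ t in a..b, f (x, t))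
      (∫ t in a..b, (fderiv ℝ f (w, t)).comp (ContinuousLinearMap.inl ℝ E ℝ)) w := by
  have : ProperSpace E := FiniteDimensional.proper_real E
  obtain ⟨ε, hε, hεD⟩ := Metric.nhds_basis_closedBall.mem_iff.1 (hD.mem_nhds hw)
  have hf' : ContinuousOn (fun p => (fderiv ℝ f p).comp (ContinuousLinearMap.inl ℝ E ℝ)) O :=
    ((hf.continuousOn_fderiv_of_isOpen hO le_rfl)).clm_comp continuousOn_const
  -- Compactness of ball times interval supplies a constant dominating function.
  have hK : IsCompact (Metric.closedBall w ε ×ˢ uIcc a b) :=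
    (isCompact_closedBall w ε).prod isCompact_uIcc
  have hKO : Metric.closedBall w ε ×ˢ uIcc a b ⊆ O := fun p hp => hDO p.1 (hεD hp.1) p.2 hp.2
  obtain ⟨C, hC⟩ := hK.exists_bound_of_continuousOn (hf'.mono hKO)
  refine intervalIntegral.hasFDerivAt_integral_of_dominated_of_fderiv_le
    (F := fun x t => f (x, t))
    (F' := fun x t => (fderiv ℝ f (x, t)).comp (ContinuousLinearMap.inl ℝ E ℝ))
    (bound := fun _ => C) (s := Metric.closedBall w ε) (Metric.closedBall_mem_nhds w hε)
    ?_ ?_ ?_ ?_ ?_ ?_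
  · filter_upwards [hD.mem_nhds hw] with x hx
    exact ((hf.continuousOn.uIcc_section (hDO x hx)).mono uIoc_subset_uIcc).aestronglyMeasurable
      measurableSet_uIoc
  · exact (hf.continuousOn.uIcc_section (hDO w hw)).intervalIntegrable
  · exact ((hf'.uIcc_section (hDO w hw)).mono uIoc_subset_uIcc).aestronglyMeasurable
      measurableSet_uIoc
  · exact .of_forall fun t ht x hx => hC (x, t) ⟨hx, uIoc_subset_uIcc ht⟩
  · exact intervalIntegrable_const
  · refine .of_forall fun t ht x hx => ?_
    have h1 := ((hf.contDiffAt (hO.mem_nhds (hDO x (hεD hx) t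
      (uIoc_subset_uIcc ht)))).differentiableAt one_ne_zero).hasFDerivAt
    exact h1.comp x (hasFDerivAt_prodMk_left x t)

/-- Induction on the order of differentiability. The codomain has to vary, since the derivative is
again such an integral, with values in `E →L[ℝ] F`. -/
theorem contDiffOn_intervalIntegral {O : Set (E × ℝ)} (hO : IsOpen O)
    {f : E × ℝ → F} (hf : ContDiffOn ℝ ∞ f O) {D : Set E} (hD : IsOpen D) {a b : ℝ}
    (hDO : ∀ w ∈ D, ∀ t ∈ uIcc a b, (w, t) ∈ O) :
    ContDiffOn ℝ ∞ (fun x => ∫ t in a..b, f (x, t)) D := by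
  rw [contDiffOn_infty]
  intro n
  have hd {F : Type} [NormedAddCommGroup F] [NormedSpace ℝ F] {f : E × ℝ → F}
      (hf : ContDiffOn ℝ ∞ f O) {w : E} (hw : w ∈ D) :=
    hasFDerivAt_intervalIntegral_of_contDiffOn hO (hf.of_le (by simp)) hD hDO hw
  induction n generalizing F with
  | zero => exact contDiffOn_zero.2 fun w hw => (hd hf hw).continuousAt.continuousWithinAt
  | succ n ih =>
    push_cast
    rw [contDiffOn_succ_iff_fderiv_of_isOpen hD]
    refine ⟨fun w hw => (hd hf hw).differentiableAt.differentiableWithinAt, by simp, ?_⟩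
    refine (ih (f := fun p => (fderiv ℝ f p).comp (ContinuousLinearMap.inl ℝ E ℝ)) ?_).congr
      fun w hw => (hd hf hw).fderiv
    exact (hf.fderiv_of_isOpen hO (by simp)).clm_comp contDiffOn_const

end ParametricIntegral

/-! ### The Poincaré lemma along the leaves of a projection -/

section Poincare

variable {E : Type} [NormedAddCommGroup E] [NormedSpace ℝ E] [FiniteDimensional ℝ E]

/-- The primitive, along the directions in the range of `P`, of the one-form `α`. -/
noncomputable def leafPrimitive (P : E →L[ℝ] E) (α : E → E →L[ℝ] ℝ) (w : E) : ℝ :=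
  ∫ t in (0 : ℝ)..1, α (w - (1 - t) • P w) (P w)

variable {P : E →L[ℝ] E} {D : Set E} {α : E → E →L[ℝ] ℝ}

omit [FiniteDimensional ℝ E] in
-- For fixed `w` the path runs from `w - P w` at time `0` to `w` at time `1` with velocity `P w`,
-- hence inside the leaf `w + range P`; the transverse coordinates act as parameters.
theorem contDiff_leafPath :
    ContDiff ℝ ∞ (fun p : E × ℝ => p.1 - (1 - p.2) • P p.1) := by
  fun_prop

theorem contDiffOn_leafPrimitive (hD : IsOpen D)
    (hPD : ∀ w ∈ D, ∀ t ∈ Icc (0 : ℝ) 1, w - (1 - t) • P w ∈ D) (hα : ContDiffOn ℝ ∞ α D) :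
    ContDiffOn ℝ ∞ (leafPrimitive P α) D := by
  refine contDiffOn_intervalIntegral (f := fun p : E × ℝ => α (p.1 - (1 - p.2) • P p.1) (P p.1))
    (hD.preimage (contDiff_leafPath (P := P)).continuous) ?_ hD ?_
  · exact (hα.comp contDiff_leafPath.contDiffOn fun p hp => hp).clm_apply
      (by fun_prop)
  · intro w hw t ht
    rw [uIcc_of_le zero_le_one] at ht
    exact hPD w hw t ht

omit [FiniteDimensional ℝ E] in
-- For `α` closed along the range of an idempotent `P`, this time derivative equals the derivative
-- of the integrand of `leafPrimitive` in the direction `P u`, so differentiating under the integral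
-- gives a total derivative.
theorem HasFDerivAt.mul_leafPath {w u : E} {t : ℝ} {α' : E →L[ℝ] E →L[ℝ] ℝ}
    (h : HasFDerivAt α α' (w - (1 - t) • P w)) :
    HasDerivAt (fun s : ℝ => s * α (w - (1 - s) • P w) (P u))
      (α (w - (1 - t) • P w) (P u) + t * α' (P w) (P u)) t := by
  have e1 : HasDerivAt (fun t : ℝ => w - (1 - t) • P w) (P w) t := by
    have := (((hasDerivAt_id t).const_sub 1).smul_const (P w)).const_sub w
    simpa using this
  have e2 : HasDerivAt (fun s : ℝ => α (w - (1 - s) • P w)) (α' (P w)) t :=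
    h.comp_hasDerivAt t e1
  have e3 : HasDerivAt (fun s : ℝ => α (w - (1 - s) • P w) (P u)) (α' (P w) (P u)) t :=
    (ContinuousLinearMap.apply ℝ ℝ (P u)).hasFDerivAt.comp_hasDerivAt t e2
  simpa using (hasDerivAt_id' t).fun_mul e3

omit [FiniteDimensional ℝ E] in
theorem HasFDerivAt.leafIntegrand {w : E} {t : ℝ} {α' : E →L[ℝ] E →L[ℝ] ℝ}
    (h : HasFDerivAt α α' (w - (1 - t) • P w)) :
    HasFDerivAt (fun x : E => α (x - (1 - t) • P x) (P x))
      ((α (w - (1 - t) • P w)).comp P +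
        (α'.comp (ContinuousLinearMap.id ℝ E - (1 - t) • P)).flip (P w)) w := by
  have e4 : HasFDerivAt (fun x : E => x - (1 - t) • P x)
      (ContinuousLinearMap.id ℝ E - (1 - t) • P) w :=
    (hasFDerivAt_id w).sub (P.hasFDerivAt.const_smul (1 - t))
  have e5 : HasFDerivAt (fun x : E => α (x - (1 - t) • P x))
      (α'.comp (ContinuousLinearMap.id ℝ E - (1 - t) • P)) w := h.comp w e4
  exact e5.clm_apply P.hasFDerivAt

/-- The Poincaré lemma with parameters. -/
theorem fderiv_leafPrimitive (hP : ∀ u, P (P u) = P u) (hD : IsOpen D)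
    (hPD : ∀ w ∈ D, ∀ t ∈ Icc (0 : ℝ) 1, w - (1 - t) • P w ∈ D) (hα : ContDiffOn ℝ ∞ α D)
    (hclosed : ∀ w ∈ D, ∀ u v, fderiv ℝ α w (P u) (P v) = fderiv ℝ α w (P v) (P u))
    {w : E} (hw : w ∈ D) (u : E) :
    fderiv ℝ (leafPrimitive P α) w (P u) = α w (P u) := by
  let O : Set (E × ℝ) := (fun p : E × ℝ => p.1 - (1 - p.2) • P p.1) ⁻¹' D
  have hO : IsOpen O := hD.preimage (contDiff_leafPath (P := P)).continuous
  let f : E × ℝ → ℝ := fun p => α (p.1 - (1 - p.2) • P p.1) (P p.1)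
  have hf : ContDiffOn ℝ ∞ f O :=
    (hα.comp contDiff_leafPath.contDiffOn fun p hp => hp).clm_apply (by fun_prop)
  have hDO : ∀ w ∈ D, ∀ t ∈ uIcc (0 : ℝ) 1, (w, t) ∈ O := fun w hw t ht =>
    hPD w hw t (by rwa [uIcc_of_le zero_le_one] at ht)
  have h1 := hasFDerivAt_intervalIntegral_of_contDiffOn hO (hf.of_le (by simp)) hD hDO hw
  have hf' : ContinuousOn (fun p => (fderiv ℝ f p).comp (ContinuousLinearMap.inl ℝ E ℝ)) O :=
    (hf.continuousOn_fderiv_of_isOpen hO (by simp)).clm_comp continuousOn_const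
  have hint := hf'.uIcc_section (hDO w hw)
  have hα' : ∀ t ∈ uIcc (0 : ℝ) 1, HasFDerivAt α (fderiv ℝ α (w - (1 - t) • P w))
      (w - (1 - t) • P w) := fun t ht =>
    ((hα.contDiffAt (hD.mem_nhds (hDO w hw t ht))).differentiableAt (by simp)).hasFDerivAt
  -- With `P ∘ P = P`, the integrand has derivative `α (P u) + t • α' (P u) (P w)` in the direction
  -- `P u`. Closedness swaps the last two arguments and turns this into the derivative of `t * α (P
  -- u)` along the path.
  have key : ∀ t ∈ uIcc (0 : ℝ) 1, HasDerivAt (fun t => t * α (w - (1 - t) • P w) (P u))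
      ((fderiv ℝ f (w, t)).comp (ContinuousLinearMap.inl ℝ E ℝ) (P u)) t := by
    intro t ht
    have e5 := (hα' t ht).leafIntegrand
    have e4 : HasFDerivAt f (fderiv ℝ f (w, t)) (w, t) :=
      ((hf.contDiffAt (hO.mem_nhds (hDO w hw t ht))).differentiableAt (by simp)).hasFDerivAt
    have e6 : HasFDerivAt (fun x => f (x, t))
        ((fderiv ℝ f (w, t)).comp (ContinuousLinearMap.inl ℝ E ℝ)) w :=
      HasFDerivAt.comp (f := fun x : E => (x, t)) (g := f) w e4 (hasFDerivAt_prodMk_left w t)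
    rw [e6.unique e5]
    refine (hα' t ht).mul_leafPath.congr_deriv ?_
    have e7 : P u - (1 - t) • P u = t • P u := by module
    simp only [add_apply, ContinuousLinearMap.comp_apply,
      ContinuousLinearMap.flip_apply, sub_apply, smul_apply,
      ContinuousLinearMap.id_apply, hP, e7, map_smul, smul_eq_mul]
    rw [hclosed _ (hDO w hw t ht) u w, add_comm]
  change HasFDerivAt (leafPrimitive P α) _ w at h1
  rw [h1.fderiv, ContinuousLinearMap.intervalIntegral_apply hint.intervalIntegrable,
    intervalIntegral.integral_eq_sub_of_hasDerivAt key
      (hint.clm_apply continuousOn_const).intervalIntegrable]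
  simp

end Poincare

/-! ### The inverse function theorem on a ball -/

section InverseFunction

variable {n : ℕ}

theorem fderiv_matrix_mulVec {ψ : (Fin n → ℝ) → (Fin n → ℝ)} (y u : Fin n → ℝ) :
    (Matrix.of fun i j => fderiv ℝ ψ y (Pi.single j 1) i).mulVec u = fderiv ℝ ψ y u := by
  have h : (Matrix.of fun i j => fderiv ℝ ψ y (Pi.single j 1) i) =
      LinearMap.toMatrix' (fderiv ℝ ψ y : (Fin n → ℝ) →ₗ[ℝ] (Fin n → ℝ)) := by
    ext i j
    simp [LinearMap.toMatrix'_apply]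
  rw [h, LinearMap.toMatrix'_mulVec]
  rfl

/-- The inverse function theorem, with a ball as the target. -/
theorem exists_openPartialHomeomorph_ball {ψ : (Fin n → ℝ) → (Fin n → ℝ)} {U : Set (Fin n → ℝ)}
    (hU : IsOpen U) (hψ : ContDiffOn ℝ ∞ ψ U) {p : Fin n → ℝ} (hp : p ∈ U)
    (hinj : ∀ u, fderiv ℝ ψ p u = 0 → u = 0) :
    ∃ (e : OpenPartialHomeomorph (Fin n → ℝ) (Fin n → ℝ)) (r : ℝ), 0 < r ∧ ⇑e = ψ ∧
      p ∈ e.source ∧ e.source ⊆ U ∧ e.target = Metric.ball (ψ p) r ∧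
      ContDiffOn ℝ ∞ e.symm e.target ∧
      ∀ y ∈ e.source, IsUnit (Matrix.of fun i j => fderiv ℝ ψ y (Pi.single j 1) i).det := by
  let J : (Fin n → ℝ) → Matrix (Fin n) (Fin n) ℝ :=
    fun y => Matrix.of fun i j => fderiv ℝ ψ y (Pi.single j 1) i
  have hJ : ∀ y u, (J y).mulVec u = fderiv ℝ ψ y u := fderiv_matrix_mulVec
  have hequiv : ∀ y, (J y).det ≠ 0 → ∃ f : (Fin n → ℝ) ≃L[ℝ] (Fin n → ℝ),
      (f : (Fin n → ℝ) →L[ℝ] (Fin n → ℝ)) = fderiv ℝ ψ y := by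
    intro y hy
    have h1 : Function.Injective (fderiv ℝ ψ y : (Fin n → ℝ) →ₗ[ℝ] (Fin n → ℝ)) := by
      refine (injective_iff_map_eq_zero _).2 fun u hu => ?_
      exact Matrix.eq_zero_of_mulVec_eq_zero hy ((hJ y u).trans hu)
    refine ⟨(LinearEquiv.ofInjectiveEndo _ h1).toContinuousLinearEquiv, ?_⟩
    ext; rfl
  have hJp : (J p).det ≠ 0 := by
    intro h0
    obtain ⟨u, hu, hu0⟩ := Matrix.exists_mulVec_eq_zero_iff.2 h0
    exact hu (hinj u ((hJ p u).symm.trans hu0))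
  have hJc : ContinuousOn (fun y => (J y).det) U := by
    refine (Continuous.matrix_det continuous_id).comp_continuousOn
      (continuousOn_pi.2 fun i => continuousOn_pi.2 fun j => ?_)
    exact continuousOn_pi.1
      ((hψ.continuousOn_fderiv_of_isOpen hU (by simp)).clm_apply continuousOn_const) i
  have hd : ∀ y ∈ U, ContDiffAt ℝ ∞ ψ y := fun y hy => hψ.contDiffAt (hU.mem_nhds hy)
  obtain ⟨f, hf⟩ := hequiv p hJp
  have hfp : HasFDerivAt ψ (f : (Fin n → ℝ) →L[ℝ] (Fin n → ℝ)) p := by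
    rw [hf]; exact ((hd p hp).differentiableAt (by simp)).hasFDerivAt
  let e₀ := (hd p hp).toOpenPartialHomeomorph ψ hfp (by simp)
  have he₀ : ⇑e₀ = ψ := rfl
  have hp₀ : p ∈ e₀.source := (hd p hp).mem_toOpenPartialHomeomorph_source hfp (by simp)
  -- Nonvanishing of the Jacobian is required on the whole source, so that the inverse is smooth
  -- throughout its domain and elimination applies there.
  let N := U ∩ (fun y => (J y).det) ⁻¹' {0}ᶜ
  have hN : IsOpen N := hJc.isOpen_inter_preimage hU isOpen_compl_singleton
  let e₁ := e₀.restrOpen N hN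
  have hp₁ : p ∈ e₁.source := ⟨hp₀, hp, hJp⟩
  have hq₁ : ψ p ∈ e₁.target := e₁.map_source hp₁
  obtain ⟨r, hr, hrt⟩ := Metric.isOpen_iff.1 e₁.open_target _ hq₁
  -- Restricting the inverse makes the target a ball, which the leaf paths do not leave.
  let e := (e₁.symm.restrOpen (Metric.ball (ψ p) r) Metric.isOpen_ball).symm
  have het : e.target = Metric.ball (ψ p) r := inter_eq_right.2 hrt
  have hes : ∀ y ∈ e.source, y ∈ N := fun y hy => by
    have : y ∈ e₁.source := by
      have := e.map_source hy
      rw [← e.left_inv hy]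
      exact e₁.map_target this.1
    exact this.2
  refine ⟨e, r, hr, rfl, ?_, fun y hy => (hes y hy).1, het, ?_, fun y hy =>
    isUnit_iff_ne_zero.2 (hes y hy).2⟩
  · have h1 : ψ p ∈ e.target := by rw [het]; exact Metric.mem_ball_self hr
    have h2 := e.map_target h1
    have h3 : e.symm (ψ p) = p := e₁.left_inv hp₁
    rwa [h3] at h2
  · intro w hw
    have hy := hes _ (e.map_target hw)
    obtain ⟨g, hg⟩ := hequiv _ hy.2
    refine (e.contDiffAt_symm hw (f₀' := g) ?_ (hd _ hy.1)).contDiffWithinAt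
    rw [hg]
    exact ((hd _ hy.1).differentiableAt (by simp)).hasFDerivAt

end InverseFunction

/-! ### Staged frames and their integrals -/

theorem ContinuousLinearMap.apply_eq_sum_single {n : ℕ} (Λ : (Fin n → ℝ) →L[ℝ] ℝ)
    (u : Fin n → ℝ) : Λ u = ∑ a, u a * Λ (Pi.single a 1) := by
  conv_lhs => rw [← Finset.univ_sum_single u, map_sum]
  refine Finset.sum_congr rfl fun a _ => ?_
  rw [← smul_eq_mul, ← map_smul, ← Pi.single_smul', smul_eq_mul, mul_one]

/-- A frame of vector fields on an open subset of `ℝⁿ`, with its dual coframe, and an increasing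
filtration by stages, such that the coframe elements of each stage are closed along the
distribution spanned by the fields of this and the higher stages. -/
structure StagedFrame (n : ℕ) where
  dom : Set (Fin n → ℝ)
  isOpen_dom : IsOpen dom
  field : Fin n → (Fin n → ℝ) → (Fin n → ℝ)
  coframe : Fin n → (Fin n → ℝ) → (Fin n → ℝ) →L[ℝ] ℝ
  stage : Fin n → ℕ
  contDiffOn_field : ∀ i, ContDiffOn ℝ ∞ (field i) dom
  contDiffOn_coframe : ∀ i, ContDiffOn ℝ ∞ (coframe i) dom
  dual : ∀ y ∈ dom, ∀ i j, coframe i y (field j y) = if i = j then 1 else 0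
  bracket : ∀ y ∈ dom, ∀ i a b, stage i ≤ stage a → stage i ≤ stage b →
    coframe i y (VectorField.lieBracket ℝ (field a) (field b) y) = 0

namespace StagedFrame

variable {n : ℕ} (R : StagedFrame n)

/-- Duality makes the coframe a left inverse of the frame; in finite dimension it is then also a
right inverse. -/
theorem sum_coframe_smul {y : Fin n → ℝ} (hy : y ∈ R.dom) (u : Fin n → ℝ) :
    ∑ i, R.coframe i y u • R.field i y = u := by
  let f : (Fin n → ℝ) →ₗ[ℝ] (Fin n → ℝ) := LinearMap.pi fun i => (R.coframe i y).toLinearMap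
  let g : (Fin n → ℝ) →ₗ[ℝ] (Fin n → ℝ) := Fintype.linearCombination ℝ fun i => R.field i y
  have h : f * g = 1 := by
    ext c i
    simp [f, g, Fintype.linearCombination_apply, R.dual y hy, Pi.single_apply]
  have h' : g * f = 1 := mul_eq_one_comm.1 h
  simpa [f, g, Fintype.linearCombination_apply] using DFunLike.congr_fun h' u

theorem map_eq_sum {y : Fin n → ℝ} (hy : y ∈ R.dom) (Λ : (Fin n → ℝ) →L[ℝ] ℝ) (u : Fin n → ℝ) :
    Λ u = ∑ a, R.coframe a y u * Λ (R.field a y) := by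
  conv_lhs => rw [← R.sum_coframe_smul hy u, map_sum]
  simp

/-- Differentiate the constant $\omega^i(X_b)$ along $X_a$, and vice versa: the antisymmetric part
of the derivative of $\omega^i$ on $(X_a,X_b)$ is $-\omega^i([X_a,X_b])$, which vanishes by the
bracket condition. -/
theorem fderiv_coframe_field_symm {y : Fin n → ℝ} (hy : y ∈ R.dom) {i a b : Fin n}
    (ha : R.stage i ≤ R.stage a) (hb : R.stage i ≤ R.stage b) :
    fderiv ℝ (R.coframe i) y (R.field a y) (R.field b y) =
      fderiv ℝ (R.coframe i) y (R.field b y) (R.field a y) := by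
  have hω : HasFDerivAt (R.coframe i) (fderiv ℝ (R.coframe i) y) y :=
    (((R.contDiffOn_coframe i).contDiffAt (R.isOpen_dom.mem_nhds hy)).differentiableAt
      (by simp)).hasFDerivAt
  have key : ∀ b c, fderiv ℝ (R.coframe i) y (R.field c y) (R.field b y) +
      R.coframe i y (fderiv ℝ (R.field b) y (R.field c y)) = 0 := by
    intro b c
    have hv : HasFDerivAt (R.field b) (fderiv ℝ (R.field b) y) y :=
      (((R.contDiffOn_field b).contDiffAt (R.isOpen_dom.mem_nhds hy)).differentiableAt
        (by simp)).hasFDerivAt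
    have h1 := hω.clm_apply hv
    have h2 : HasFDerivAt (fun y => R.coframe i y (R.field b y))
        (0 : (Fin n → ℝ) →L[ℝ] ℝ) y := by
      refine (hasFDerivAt_const (if i = b then (1 : ℝ) else 0) y).congr_of_eventuallyEq ?_
      filter_upwards [R.isOpen_dom.mem_nhds hy] with z hz using R.dual z hz i b
    have h3 := DFunLike.congr_fun (h1.unique h2) (R.field c y)
    simpa [add_comm] using h3
  have h := R.bracket y hy i a b ha hb
  rw [VectorField.lieBracket, map_sub] at h
  linarith [key b a, key a b]

/-- The coframe elements are closed along the corresponding distributions. -/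
theorem fderiv_coframe_symm {y : Fin n → ℝ} (hy : y ∈ R.dom) {i : Fin n} {u w : Fin n → ℝ}
    (hu : ∀ j, R.stage j < R.stage i → R.coframe j y u = 0)
    (hw : ∀ j, R.stage j < R.stage i → R.coframe j y w = 0) :
    fderiv ℝ (R.coframe i) y u w = fderiv ℝ (R.coframe i) y w u := by
  have key : ∀ u w, fderiv ℝ (R.coframe i) y u w = ∑ a, ∑ b,
      R.coframe a y u * R.coframe b y w *
        fderiv ℝ (R.coframe i) y (R.field a y) (R.field b y) := by
    intro u w
    conv_lhs => rw [← R.sum_coframe_smul hy u, map_sum]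
    rw [sum_apply]
    refine Finset.sum_congr rfl fun a _ => ?_
    rw [R.map_eq_sum hy _ w]
    refine Finset.sum_congr rfl fun b _ => ?_
    rw [map_smul, smul_apply, smul_eq_mul]
    ring
  rw [key u w, key w u, Finset.sum_comm]
  refine Finset.sum_congr rfl fun b _ => Finset.sum_congr rfl fun a _ => ?_
  -- Components along fields of lower stage vanish by assumption; only pairs covered by `bracket`
  -- remain.
  by_cases ha : R.stage a < R.stage i
  · simp [hu a ha]
  by_cases hb : R.stage b < R.stage i
  · simp [hw b hb]
  rw [R.fderiv_coframe_field_symm hy (not_lt.1 ha) (not_lt.1 hb)]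
  ring

/-- The functions `Q i` of stage less than `l` are first integrals of the higher stages,
conjugate to the fields of the same stage. -/
structure IsIntegrals (l : ℕ) (U : Set (Fin n → ℝ)) (p : Fin n → ℝ)
    (Q : Fin n → (Fin n → ℝ) → ℝ) : Prop where
  isOpen : IsOpen U
  mem : p ∈ U
  subset : U ⊆ R.dom
  contDiffOn : ∀ i, R.stage i < l → ContDiffOn ℝ ∞ (Q i) U
  zero : ∀ i, R.stage i < l → Q i p = 0
  deriv : ∀ i, R.stage i < l → ∀ y ∈ U, ∀ m, R.stage i ≤ R.stage m →
    fderiv ℝ (Q i) y (R.field m y) = if i = m then 1 else 0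

/-- The functions `Q i` of stage less than `l`, completed to a coordinate system. -/
noncomputable def adapted (l : ℕ) (p : Fin n → ℝ) (Q : Fin n → (Fin n → ℝ) → ℝ)
    (y : Fin n → ℝ) (i : Fin n) : ℝ :=
  if R.stage i < l then Q i y else R.coframe i p (y - p)

namespace IsIntegrals

variable {R} {l : ℕ} {U : Set (Fin n → ℝ)} {p : Fin n → ℝ} {Q : Fin n → (Fin n → ℝ) → ℝ}

theorem contDiffOn_adapted (h : R.IsIntegrals l U p Q) : ContDiffOn ℝ ∞ (R.adapted l p Q) U := by
  refine contDiffOn_pi.2 fun i => ?_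
  unfold adapted
  split_ifs with hi
  · exact h.contDiffOn i hi
  · exact ((R.coframe i p).contDiff.comp (contDiff_id.sub contDiff_const)).contDiffOn

theorem adapted_self (h : R.IsIntegrals l U p Q) : R.adapted l p Q p = 0 := by
  ext i
  by_cases hi : R.stage i < l
  · simp [adapted, hi, h.zero i hi]
  · simp [adapted, hi]

theorem fderiv_adapted (h : R.IsIntegrals l U p Q) {y : Fin n → ℝ} (hy : y ∈ U)
    (u : Fin n → ℝ) (i : Fin n) :
    fderiv ℝ (R.adapted l p Q) y u i =
      if R.stage i < l then fderiv ℝ (Q i) y u else R.coframe i p u := by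
  have h1 := hasFDerivAt_pi'.1 ((h.contDiffOn_adapted.contDiffAt
    (h.isOpen.mem_nhds hy)).differentiableAt (by simp)).hasFDerivAt i
  have h2 : fderiv ℝ (fun y => R.adapted l p Q y i) y u =
    fderiv ℝ (R.adapted l p Q) y u i := by rw [h1.fderiv]; rfl
  rw [← h2]
  split_ifs with hi
  · simp only [adapted, hi, if_true]
  · simp only [adapted, hi, if_false]
    have h3 := (R.coframe i p).hasFDerivAt.comp y ((hasFDerivAt_id y).sub_const p)
    exact DFunLike.congr_fun h3.fderiv u

/-- Triangularity: $dQ_j$ is $\omega^j$ plus a combination of the $\omega^a$ of strictly lower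
stage. Strong induction on the stage thus recovers the $\omega^j$ from the $dQ_j$, so the leaves of
the known integrals are tangent to the higher stages. -/
theorem coframe_eq_zero (h : R.IsIntegrals l U p Q) {y : Fin n → ℝ} (hy : y ∈ U)
    {u : Fin n → ℝ} (hu : ∀ j, R.stage j < l → fderiv ℝ (Q j) y u = 0) (j : Fin n)
    (hj : R.stage j < l) : R.coframe j y u = 0 := by
  induction hs : R.stage j using Nat.strong_induction_on generalizing j with
  | _ s ih =>
    have h1 := hu j hj
    rw [R.map_eq_sum (h.subset hy), Finset.sum_eq_single j] at h1
    · simpa [h.deriv j hj y hy j le_rfl] using h1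
    · intro a _ ha
      by_cases has : R.stage a < s
      · rw [ih _ has a (by omega) rfl, zero_mul]
      · rw [h.deriv j hj y hy a (by omega), if_neg ha.symm, mul_zero]
    · simp

/-- A vector at `p` killed by the Jacobian is killed by the coframe: by triangularity in the stages
below `l`, and by the choice of the filler coordinates in the others. -/
theorem exists_chart (h : R.IsIntegrals l U p Q) :
    ∃ (e : OpenPartialHomeomorph (Fin n → ℝ) (Fin n → ℝ)) (r : ℝ), 0 < r ∧
      ⇑e = R.adapted l p Q ∧ p ∈ e.source ∧ e.source ⊆ U ∧ e.target = Metric.ball 0 r ∧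
      ContDiffOn ℝ ∞ e.symm e.target ∧
      ∀ y ∈ e.source, IsUnit (Matrix.of fun i j => fderiv ℝ e y (Pi.single j 1) i).det := by
  obtain ⟨e, r, hr, he, hp, hU, ht, hs, hd⟩ :=
    exists_openPartialHomeomorph_ball h.isOpen h.contDiffOn_adapted h.mem fun u hu => by
      have h1 : ∀ i, R.coframe i p u = 0 := by
        intro i
        by_cases hi : R.stage i < l
        · refine h.coframe_eq_zero h.mem (fun j hj => ?_) i hi
          have := h.fderiv_adapted h.mem u j
          rwa [hu, if_pos hj, Pi.zero_apply, eq_comm] at this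
        · have := h.fderiv_adapted h.mem u i
          rwa [hu, if_neg hi, Pi.zero_apply, eq_comm] at this
      rw [← R.sum_coframe_smul (h.subset h.mem) u]
      simp [h1]
  rw [h.adapted_self] at ht
  exact ⟨e, r, hr, he, hp, hU, ht, hs, he ▸ hd⟩

/-- The coframe is frozen at `p`, so the filler coordinates are affine functions with constant
coefficients. -/
theorem isKnown_adapted {B : Set LocalFun} (h : R.IsIntegrals l U p Q)
    (hQ : ∀ i, R.stage i < l → IsKnown B U (Q i)) (i : Fin n) :
    IsKnown B U (fun y => R.adapted l p Q y i) := by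
  unfold adapted
  split_ifs with hi
  · exact hQ i hi
  · refine IsKnown.congr (.sum h.isOpen Finset.univ fun a _ =>
      ((IsKnown.coord U h.isOpen a).sub h.isOpen (.const U h.isOpen (p a))).mul
        (.const U h.isOpen (R.coframe i p (Pi.single a 1)))) h.isOpen fun y _ => ?_
    exact ((R.coframe i p).apply_eq_sum_single (y - p)).symm

end IsIntegrals

end StagedFrame

/-! ### Pull-backs and coordinate projections -/

theorem OpenPartialHomeomorph.fderiv_symm_fderiv {n : ℕ}
    (e : OpenPartialHomeomorph (Fin n → ℝ) (Fin n → ℝ))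
    (he : ContDiffOn ℝ ∞ e e.source) (hsymm : ContDiffOn ℝ ∞ e.symm e.target)
    {y : Fin n → ℝ} (hy : y ∈ e.source) (u : Fin n → ℝ) :
    fderiv ℝ e.symm (e y) (fderiv ℝ e y u) = u := by
  have h1 := ((he.contDiffAt (e.open_source.mem_nhds hy)).differentiableAt
    (by simp)).hasFDerivAt
  have h2 := ((hsymm.contDiffAt (e.open_target.mem_nhds (e.map_source hy))).differentiableAt
    (by simp)).hasFDerivAt
  have h3 : HasFDerivAt (e.symm ∘ e) (ContinuousLinearMap.id ℝ (Fin n → ℝ)) y := by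
    refine (hasFDerivAt_id y).congr_of_eventuallyEq ?_
    filter_upwards [e.open_source.mem_nhds hy] with z hz using e.left_inv hz
  exact DFunLike.congr_fun ((h2.comp y h1).unique h3) u

theorem OpenPartialHomeomorph.fderiv_fderiv_symm {n : ℕ}
    (e : OpenPartialHomeomorph (Fin n → ℝ) (Fin n → ℝ))
    (he : ContDiffOn ℝ ∞ e e.source) (hsymm : ContDiffOn ℝ ∞ e.symm e.target)
    {w : Fin n → ℝ} (hw : w ∈ e.target) (u : Fin n → ℝ) :
    fderiv ℝ e (e.symm w) (fderiv ℝ e.symm w u) = u := by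
  have h := e.symm.fderiv_symm_fderiv hsymm he hw u
  exact h

/-- The exterior derivative of the pull-back of a one-form. -/
theorem fderiv_pullback_symm {E : Type*} [NormedAddCommGroup E] [NormedSpace ℝ E]
    {β : E → E →L[ℝ] ℝ} {θ : E → E} {w : E} (hθ : ContDiffAt ℝ ∞ θ w)
    (hβ : DifferentiableAt ℝ β (θ w)) {u v : E}
    (h : fderiv ℝ β (θ w) (fderiv ℝ θ w u) (fderiv ℝ θ w v) =
      fderiv ℝ β (θ w) (fderiv ℝ θ w v) (fderiv ℝ θ w u)) :
    fderiv ℝ (fun w => (β (θ w)).comp (fderiv ℝ θ w)) w u v =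
      fderiv ℝ (fun w => (β (θ w)).comp (fderiv ℝ θ w)) w v u := by
  have h1 : HasFDerivAt (fun w => β (θ w)) ((fderiv ℝ β (θ w)).comp (fderiv ℝ θ w)) w :=
    hβ.hasFDerivAt.comp w (hθ.differentiableAt (by simp)).hasFDerivAt
  have h2 : HasFDerivAt (fderiv ℝ θ) (fderiv ℝ (fderiv ℝ θ) w) w :=
    ((hθ.fderiv_right (m := 1) (WithTop.coe_le_coe.2 le_top)).differentiableAt
      one_ne_zero).hasFDerivAt
  -- The second derivative of `θ` contributes a symmetric term, so antisymmetry can only come from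
  -- `β`.
  have h3 : IsSymmSndFDerivAt ℝ θ w := hθ.isSymmSndFDerivAt <| by
    rw [minSmoothness_of_isRCLikeNormedField]
    exact WithTop.coe_le_coe.2 le_top
  rw [(h1.clm_comp h2).fderiv]
  have h4 := h3 u v
  simp only [add_apply, ContinuousLinearMap.comp_apply, ContinuousLinearMap.compL_apply,
    ContinuousLinearMap.flip_apply]
  rw [h, h4]

/-- The projection that annihilates the coordinates outside `s`. -/
def coordProjection {n : ℕ} (s : Set (Fin n)) [DecidablePred (· ∈ s)] :
    (Fin n → ℝ) →L[ℝ] (Fin n → ℝ) :=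
  ContinuousLinearMap.pi fun i => if i ∈ s then ContinuousLinearMap.proj i else 0

section coordProjection

variable {n : ℕ} (s : Set (Fin n)) [DecidablePred (· ∈ s)]

theorem coordProjection_apply (u : Fin n → ℝ) (i : Fin n) :
    coordProjection s u i = if i ∈ s then u i else 0 := by
  simp only [coordProjection, ContinuousLinearMap.coe_pi']
  split_ifs <;> rfl

theorem coordProjection_idem (u : Fin n → ℝ) :
    coordProjection s (coordProjection s u) = coordProjection s u := by
  ext i
  simp only [coordProjection_apply]
  split_ifs <;> rfl

/-- In the sup norm it suffices that each coordinate is either kept or multiplied by `t ∈ [0, 1]`.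
-/
theorem leafPath_mem_ball {r : ℝ} {w : Fin n → ℝ} (hw : w ∈ Metric.ball (0 : Fin n → ℝ) r)
    {t : ℝ} (ht : t ∈ Icc (0 : ℝ) 1) :
    w - (1 - t) • coordProjection s w ∈ Metric.ball (0 : Fin n → ℝ) r := by
  rw [mem_ball_zero_iff] at hw ⊢
  refine lt_of_le_of_lt ((pi_norm_le_iff_of_nonneg (norm_nonneg w)).2 fun i => ?_) hw
  refine le_trans ?_ (norm_le_pi_norm w i)
  simp only [Pi.sub_apply, Pi.smul_apply, coordProjection_apply, smul_eq_mul]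
  split_ifs
  · rw [show w i - (1 - t) * w i = t * w i by ring, norm_mul]
    exact mul_le_of_le_one_left (norm_nonneg _) (by rw [Real.norm_of_nonneg ht.1]; exact ht.2)
  · simp

end coordProjection

/-! ### One quadrature for all forms of a stage -/

section Quadrature

variable {n : ℕ} {B : Set LocalFun}

/-- The primitives of finitely many known one-forms along the directions of a coordinate plane
are all obtained by a single quadrature, which has the coefficients of a linear combination of the
one-forms as additional parameters. -/
theorem exists_quadrature_leafPrimitive (s : Set (Fin n)) [DecidablePred (· ∈ s)] (r : ℝ)
    (α : Fin n → (Fin n → ℝ) → (Fin n → ℝ) →L[ℝ] ℝ)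
    (hα : ∀ i a, IsKnown B (Metric.ball 0 r) (fun w => α i w (Pi.single a 1))) :
    ∃ F : LocalFun, IsQuadrature B F ∧ ∀ i, IsKnown {F} (Metric.ball 0 r)
      (leafPrimitive (coordProjection s) (α i)) := by
  let π : (Fin (n + n) → ℝ) → (Fin n → ℝ) := fun z j => z (Fin.castAdd n j)
  have hπ : Continuous π := by fun_prop
  let S : (Fin (n + n + 1) → ℝ) → (Fin n → ℝ) := fun z =>
    π (fun j => z j.castSucc) - (1 - z (Fin.last _)) • coordProjection s (π fun j => z j.castSucc)
  have hS : Continuous S := by fun_prop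
  -- The variables are the point (`n` slots), the coefficients of the linear combination (`n` slots)
  -- and the integration variable (last slot).
  let f : (Fin (n + n + 1) → ℝ) → ℝ := fun z => ∑ i, z (Fin.natAdd n i).castSucc *
    ∑ a, coordProjection s (π fun j => z j.castSucc) a * α i (S z) (Pi.single a 1)
  let W : Set (Fin (n + n + 1) → ℝ) := S ⁻¹' Metric.ball 0 r
  have hW : IsOpen W := Metric.isOpen_ball.preimage hS
  have hD : IsOpen (π ⁻¹' Metric.ball 0 r) := Metric.isOpen_ball.preimage hπ
  let F : LocalFun := ⟨n + n, π ⁻¹' Metric.ball 0 r, fun z => ∫ t in (0 : ℝ)..1, f (Fin.snoc z t)⟩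
  have hproj : ∀ a, IsKnown B W fun z => coordProjection s (π fun j => z j.castSucc) a := by
    intro a
    simp only [coordProjection_apply]
    split_ifs
    · exact .coord W hW _
    · exact .const W hW _
  have hSk : ∀ a, IsKnown B W fun z => S z a := fun a =>
    (IsKnown.coord W hW _).sub hW
      (((IsKnown.const W hW 1).sub hW (.coord W hW _)).mul (hproj a))
  have hf : IsKnown B W f := .sum hW _ fun i _ => (IsKnown.coord W hW _).mul <|
    .sum hW _ fun a _ => (hproj a).mul ((hα i a).comp hW hSk fun z hz => hz)
  have hsnoc : ∀ (z : Fin (n + n) → ℝ) (t : ℝ), (fun j : Fin (n + n) =>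
      (Fin.snoc z t : Fin (n + n + 1) → ℝ) j.castSucc) = z := fun z t => by
    ext j; exact Fin.snoc_castSucc (α := fun _ => ℝ) t z j
  have hlast : ∀ (z : Fin (n + n) → ℝ) (t : ℝ),
      (Fin.snoc z t : Fin (n + n + 1) → ℝ) (Fin.last _) = t := fun z t =>
    Fin.snoc_last (α := fun _ => ℝ) t z
  have hSsnoc : ∀ z t, S (Fin.snoc z t) = π z - (1 - t) • coordProjection s (π z) := by
    intro z t
    simp only [S, hsnoc, hlast]
  refine ⟨F, ⟨hD, W, f, fun _ => 0, fun _ => 1, hf, .const _ hD 0, .const _ hD 1,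
    fun z hz => ⟨fun t ht => ?_, rfl⟩⟩, fun i => ?_⟩
  · rw [uIcc_of_le zero_le_one] at ht
    change S (Fin.snoc z t) ∈ Metric.ball 0 r
    rw [hSsnoc]
    exact leafPath_mem_ball s hz ht
  · have hb : IsOpen (Metric.ball (0 : Fin n → ℝ) r) := Metric.isOpen_ball
    have hπa : ∀ w c : Fin n → ℝ, π (Fin.append w c) = w := fun w c => by
      ext j; exact Fin.append_left w c j
    -- Substituting the `i`-th unit vector for the coefficients isolates the `i`-th primitive.
    have hk := (IsKnown.base F rfl : IsKnown {F} F.dom F.toFun).comp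
      (g := fun j w => (Fin.append w (Pi.single i 1) : Fin (n + n) → ℝ) j) hb
      (fun j => ?_) (fun w hw => ?_)
    · refine hk.congr hb fun w hw => intervalIntegral.integral_congr fun t _ => ?_
      change f (Fin.snoc (Fin.append w (Pi.single i 1)) t) = _
      simp only [f, hSsnoc, hπa]
      simp only [hsnoc, hπa]
      have hc : ∀ j, (Fin.snoc (Fin.append w (Pi.single i 1)) t : Fin (n + n + 1) → ℝ)
          (Fin.natAdd n j).castSucc = (Pi.single i 1 : Fin n → ℝ) j := fun j =>
        (Fin.snoc_castSucc (α := fun _ => ℝ) t _ _).trans (Fin.append_right w _ j)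
      simp only [hc, ← ContinuousLinearMap.apply_eq_sum_single]
      simp [Pi.single_apply]
    · refine Fin.addCases (fun a => ?_) (fun a => ?_) j
      · simpa only [Fin.append_left] using IsKnown.coord _ hb a
      · simpa only [Fin.append_right] using IsKnown.const _ hb ((Pi.single i 1 : Fin n → ℝ) a)
    · change π (Fin.append w (Pi.single i 1)) ∈ Metric.ball 0 r
      rwa [hπa]

end Quadrature

/-! ### Induction over the stages -/

namespace StagedFrame

variable {n : ℕ} {R : StagedFrame n} {B : Set LocalFun} {l : ℕ} {U : Set (Fin n → ℝ)}
  {p : Fin n → ℝ} {Q : Fin n → (Fin n → ℝ) → ℝ}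

namespace IsIntegrals

/-- One more quadrature yields the integrals of the next stage. -/
theorem exists_next (hB : ∀ i a, IsKnown B R.dom (fun y => R.coframe i y (Pi.single a 1)))
    (h : R.IsIntegrals l U p Q) (hQ : ∀ i, R.stage i < l → IsKnown B U (Q i)) :
    ∃ (F : LocalFun) (U' : Set (Fin n → ℝ)) (Q' : Fin n → (Fin n → ℝ) → ℝ),
      IsQuadrature B F ∧ U' ⊆ U ∧ R.IsIntegrals (l + 1) U' p Q' ∧
      (∀ i, R.stage i < l → Q' i = Q i) ∧
      ∀ i, R.stage i = l → IsKnown (B ∪ {F}) U' (Q' i) := by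
  classical
  obtain ⟨e, r, hr, he, hp, heU, het, hsymm, hdet⟩ := h.exists_chart
  have hedom : e.source ⊆ R.dom := heU.trans h.subset
  have hsm : ContDiffOn ℝ ∞ e e.source := he ▸ h.contDiffOn_adapted.mono heU
  have hek : ∀ i, IsKnown B e.source fun y => e y i := fun i => by
    rw [he]; exact (h.isKnown_adapted hQ i).mono_set e.open_source heU
  have hθk := IsKnown.localInverse e hek hsm hsymm hdet
  have hθd : ∀ w ∈ e.target, HasFDerivAt e.symm (fderiv ℝ e.symm w) w := fun w hw =>
    ((hsymm.contDiffAt (e.open_target.mem_nhds hw)).differentiableAt (by simp)).hasFDerivAt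
  -- The coframe in the adapted coordinates `e`. It is known without a new integration: the inverse
  -- comes from elimination, its Jacobian from partial differentiation.
  let α : Fin n → (Fin n → ℝ) → (Fin n → ℝ) →L[ℝ] ℝ := fun i w =>
    (R.coframe i (e.symm w)).comp (fderiv ℝ e.symm w)
  have hαk : ∀ i a, IsKnown B (Metric.ball 0 r) fun w => α i w (Pi.single a 1) := by
    intro i a
    rw [← het]
    refine IsKnown.congr (.sum e.open_target Finset.univ fun b _ =>
      ((hθk b).partialDeriv a).mul ((hB i b).comp e.open_target hθk fun w hw =>
        hedom (e.map_target hw))) e.open_target fun w hw => ?_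
    refine Eq.trans ?_ ((R.coframe i (e.symm w)).apply_eq_sum_single _).symm
    refine Finset.sum_congr rfl fun b _ => ?_
    have := (hasFDerivAt_pi'.1 (hθd w hw) b).fderiv
    rw [this]
    rfl
  -- In the coordinates `e` the leaves are the planes on which the coordinates of stage below `l`
  -- are fixed.
  let s : Set (Fin n) := {i | l ≤ R.stage i}
  obtain ⟨F, hF, hFk⟩ := exists_quadrature_leafPrimitive s r α hαk
  let H : Fin n → (Fin n → ℝ) → ℝ := fun i => leafPrimitive (coordProjection s) (α i)
  have hb : IsOpen (Metric.ball (0 : Fin n → ℝ) r) := Metric.isOpen_ball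
  have hαsm : ∀ i, ContDiffOn ℝ ∞ (α i) (Metric.ball 0 r) := fun i => by
    rw [← het]
    exact ((R.contDiffOn_coframe i).comp hsymm fun w hw => hedom (e.map_target hw)).clm_comp
      (hsymm.fderiv_of_isOpen e.open_target (by simp))
  have hPD := fun w (hw : w ∈ Metric.ball (0 : Fin n → ℝ) r) t ht =>
    leafPath_mem_ball (t := t) s hw ht
  have hHsm : ∀ i, ContDiffOn ℝ ∞ (H i) (Metric.ball 0 r) := fun i =>
    contDiffOn_leafPrimitive hb hPD (hαsm i)
  have hfd : ∀ y ∈ e.source, ∀ j, R.stage j < l → ∀ u, fderiv ℝ e y u j = fderiv ℝ (Q j) y u := by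
    intro y hy j hj u
    rw [he, h.fderiv_adapted (heU hy), if_pos hj]
  -- Tangent vectors of a leaf are killed by the $dQ_j$ of stage below `l`, hence by the
  -- corresponding coframe elements; this is what closedness needs.
  have htan : ∀ w ∈ e.target, ∀ u, ∀ j, R.stage j < l →
      R.coframe j (e.symm w) (fderiv ℝ e.symm w (coordProjection s u)) = 0 := by
    intro w hw u
    have hy := e.map_target hw
    refine h.coframe_eq_zero (heU hy) fun j hj => ?_
    rw [← hfd _ hy j hj, e.fderiv_fderiv_symm hsm hsymm hw, coordProjection_apply, if_neg]
    exact not_le.2 hj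
  have hmaps : MapsTo e e.source (Metric.ball 0 r) := fun y hy => het ▸ e.map_source hy
  -- Indices of stage above `l` also receive a primitive, but no derivative property is asserted for
  -- it.
  refine ⟨F, e.source, fun i => if R.stage i < l then Q i else fun y => H i (e y), hF, heU,
    ⟨e.open_source, hp, hedom, fun i hi => ?_, fun i hi => ?_, fun i hi y hy m hm => ?_⟩,
    fun i hi => if_pos hi, fun i hi => ?_⟩
  · split_ifs with hi'
    · exact (h.contDiffOn i hi').mono heU
    · exact (hHsm i).comp hsm hmaps
  · split_ifs with hi'
    · exact h.zero i hi'
    · have : e p = 0 := by rw [he, h.adapted_self]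
      simp [H, leafPrimitive, this]
  · by_cases hi' : R.stage i < l
    · simp only [if_pos hi']
      exact h.deriv i hi' y (heU hy) m hm
    · simp only [if_neg hi']
      have hil : R.stage i = l := by omega
      have h1 := (((hHsm i).contDiffAt (hb.mem_nhds (hmaps hy))).differentiableAt
        (by simp)).hasFDerivAt.comp y ((hsm.contDiffAt
          (e.open_source.mem_nhds hy)).differentiableAt (by simp)).hasFDerivAt
      have h2 : fderiv ℝ (fun y => H i (e y)) y (R.field m y) =
          fderiv ℝ (H i) (e y) (fderiv ℝ e y (R.field m y)) :=
        DFunLike.congr_fun h1.fderiv _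
      -- Fields of stage at least `l` are tangent to the leaves, because the earlier $Q_j$ are
      -- constant along them.
      have h3 : coordProjection s (fderiv ℝ e y (R.field m y)) = fderiv ℝ e y (R.field m y) := by
        ext j
        rw [coordProjection_apply]
        split_ifs with hj
        · rfl
        · have hj' : R.stage j < l := not_le.1 hj
          rw [hfd y hy j hj', h.deriv j hj' y (heU hy) m (by omega), if_neg]
          rintro rfl
          omega
      have h4 := fderiv_leafPrimitive (coordProjection_idem s) hb hPD (hαsm i)
        (fun w hw u v => fderiv_pullback_symm (hsymm.contDiffAt (e.open_target.mem_nhds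
          (het ▸ hw))) (((R.contDiffOn_coframe i).contDiffAt (R.isOpen_dom.mem_nhds
            (hedom (e.map_target (het ▸ hw))))).differentiableAt (by simp))
          (R.fderiv_coframe_symm (hedom (e.map_target (het ▸ hw)))
            (fun j hj => htan w (het ▸ hw) u j (hil ▸ hj))
            (fun j hj => htan w (het ▸ hw) v j (hil ▸ hj)))) (hmaps hy)
        (fderiv ℝ e y (R.field m y))
      rw [h3] at h4
      rw [h2]
      refine h4.trans ?_
      change R.coframe i (e.symm (e y)) (fderiv ℝ e.symm (e y) _) = _
      rw [e.fderiv_symm_fderiv hsm hsymm hy, e.left_inv hy, R.dual y (hedom hy)]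
  · simp only [if_neg (show ¬ R.stage i < l by omega)]
    exact ((hFk i).mono subset_union_right).comp e.open_source
      (fun j => (hek j).mono subset_union_left) hmaps

end IsIntegrals

/-- Stage `l` uses the quadrature with index `l`, so a function of stage `i` depends on the
quadratures up to `i` only; this bookkeeping gives the refined count in the theorem. -/
theorem exists_integrals (R : StagedFrame n)
    (hB : ∀ i a, IsKnown B R.dom (fun y => R.coframe i y (Pi.single a 1))) (hp : p ∈ R.dom)
    (l : ℕ) : ∃ (F : ℕ → LocalFun) (U : Set (Fin n → ℝ)) (Q : Fin n → (Fin n → ℝ) → ℝ),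
      (∀ j < l, IsQuadrature (B ∪ F '' Iio j) (F j)) ∧ R.IsIntegrals l U p Q ∧
      ∀ i, R.stage i < l → IsKnown (B ∪ F '' Iic (R.stage i)) U (Q i) := by
  induction l with
  | zero =>
    exact ⟨fun _ => ⟨0, ∅, 0⟩, R.dom, fun _ _ => 0, by simp,
      ⟨R.isOpen_dom, hp, subset_rfl, by simp, by simp, by simp⟩, by simp⟩
  | succ l ih =>
    obtain ⟨F, U, Q, hF, h, hQ⟩ := ih
    obtain ⟨G, U', Q', hG, hU, h', hQQ, hQ'⟩ := h.exists_next (B := B ∪ F '' Iio l)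
      (fun i a => (hB i a).mono subset_union_left) fun i hi =>
        (hQ i hi).mono (union_subset_union_right _ (image_mono (Iic_subset_Iio.2 hi)))
    have hup : ∀ j < l, Function.update F l G j = F j := fun j hj =>
      Function.update_of_ne hj.ne _ _
    have himg : ∀ s : Set ℕ, s ⊆ Iio l → Function.update F l G '' s = F '' s := fun s hs =>
      image_congr fun j hj => hup j (hs hj)
    refine ⟨Function.update F l G, U', Q', fun j hj => ?_, h', fun i hi => ?_⟩
    · rw [himg _ (Iio_subset_Iio (by omega))]
      rcases (Nat.lt_succ_iff_lt_or_eq.1 hj) with hj | rfl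
      · rw [hup j hj]; exact hF j hj
      · rw [Function.update_self]; exact hG
    · rcases (Nat.lt_succ_iff_lt_or_eq.1 hi) with hi | hi
      · rw [hQQ i hi, himg _ (Iic_subset_Iio.2 hi)]
        exact (hQ i hi).mono_set h'.isOpen hU
      · refine (hQ' i hi).mono ?_
        rw [union_assoc]
        refine union_subset_union_right _ (union_subset ?_ ?_)
        · rw [← himg _ subset_rfl, hi]
          exact image_mono Iio_subset_Iic_self
        · rw [singleton_subset_iff, hi]
          exact ⟨l, mem_Iic.2 le_rfl, Function.update_self ..⟩

end StagedFrame

/-! ### Bases adapted to a filtration -/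

section AdaptedBasis

variable {K V : Type*} [Field K] [AddCommGroup V] [Module K V]

/-- Built from the smallest space upwards: the induction hypothesis is applied to the shifted
filtration, and its largest set is extended to span `A 0`. -/
theorem exists_nested_linearIndependent (k : ℕ) (A : ℕ → Submodule K V) (hA : Antitone A) :
    ∃ S : ℕ → Set V, (∀ l ≤ k, LinearIndepOn K id (S l) ∧ Submodule.span K (S l) = A l) ∧
      ∀ l < k, S (l + 1) ⊆ S l := by
  induction k generalizing A with
  | zero =>
    obtain ⟨b, hb, -, hspan, hind⟩ :=
      exists_linearIndepOn_id_extension (linearIndepOn_empty K id) (empty_subset (A 0 : Set V))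
    refine ⟨fun _ => b, fun l hl => ?_, by simp⟩
    obtain rfl : l = 0 := by omega
    exact ⟨hind, le_antisymm (Submodule.span_le.2 hb) hspan⟩
  | succ k ih =>
    obtain ⟨S, hS, hS'⟩ := ih (fun l => A (l + 1)) fun l m h => hA (by omega)
    have h0 : S 0 ⊆ (A 0 : Set V) := by
      rw [← Submodule.span_le, (hS 0 (Nat.zero_le _)).2]
      exact hA (by omega)
    obtain ⟨b, hb, hSb, hspan, hind⟩ :=
      exists_linearIndepOn_id_extension (hS 0 (Nat.zero_le _)).1 h0
    refine ⟨fun l => l.casesOn b S, fun l hl => ?_, fun l hl => ?_⟩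
    · cases l with
      | zero => exact ⟨hind, le_antisymm (Submodule.span_le.2 hb) hspan⟩
      | succ l => exact hS l (by omega)
    · cases l with
      | zero => exact hSb
      | succ l => exact hS' l (by omega)

/-- A basis adapted to a decreasing filtration. -/
theorem exists_basis_adapted [FiniteDimensional K V] {n : ℕ} (hn : Module.finrank K V = n) (k : ℕ)
    (A : ℕ → Submodule K V) (hA : Antitone A) (h0 : A 0 = ⊤) :
    ∃ (b : Module.Basis (Fin n) K V) (s : Fin n → ℕ), (∀ i, s i ≤ k) ∧
      ∀ l ≤ k, Submodule.span K (b '' {i | l ≤ s i}) = A l := by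
  classical
  obtain ⟨S, hS, hS'⟩ := exists_nested_linearIndependent k A hA
  have hanti : ∀ l m, l ≤ m → m ≤ k → S m ⊆ S l := by
    intro l m hlm
    induction m, hlm using Nat.le_induction with
    | base => exact fun _ => subset_rfl
    | succ m _ ih => exact fun hm => (hS' m (by omega)).trans (ih (by omega))
  let b₀ : Module.Basis (S 0) K V := Module.Basis.mk (v := Subtype.val) (hS 0 (Nat.zero_le _)).1
    (by rw [Subtype.range_coe_subtype, ofPred_mem_eq, (hS 0 (Nat.zero_le _)).2, h0])
  have hb₀ : ∀ x, b₀ x = x := fun x => Module.Basis.mk_apply _ _ x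
  have : Fintype (S 0) := FiniteDimensional.fintypeBasisIndex b₀
  let eqv : S 0 ≃ Fin n :=
    Fintype.equivFinOfCardEq ((Module.finrank_eq_card_basis b₀).symm.trans hn)
  -- The stage is the last `l ≤ k` whose set contains the basis vector.
  let s : Fin n → ℕ := fun i => Nat.findGreatest (fun l => (eqv.symm i : V) ∈ S l) k
  refine ⟨b₀.reindex eqv, s, fun i => Nat.findGreatest_le k, fun l hl => ?_⟩
  rw [← (hS l hl).2]
  congr 1
  ext x
  constructor
  · rintro ⟨i, hi, rfl⟩
    have h1 : (eqv.symm i : V) ∈ S (s i) :=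
      Nat.findGreatest_spec (P := fun l => (eqv.symm i : V) ∈ S l) (Nat.zero_le k) (eqv.symm i).2
    simpa [hb₀] using hanti l (s i) hi (Nat.findGreatest_le k) h1
  · intro hx
    refine ⟨eqv ⟨x, hanti 0 l (Nat.zero_le _) hl hx⟩, ?_, by simp [hb₀]⟩
    exact Nat.le_findGreatest hl (by simpa using hx)

end AdaptedBasis

/-! ### The series of `Γ` and the formal sum `Ξ` -/

section LieSeries

variable {n : ℕ} {M : Type*} [TopologicalSpace M] [ChartedSpace (EuclideanSpace ℝ (Fin n)) M]
  {L : Submodule ℝ (VField n M)} {Γ : VField n M}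

theorem mlieBracket_mem_lieSeries {l : ℕ} {X Y : VField n M} (hX : X ∈ lieSeries L Γ l)
    (hY : Y ∈ lieSeries L Γ l) : VectorField.mlieBracket (𝓡 n) X Y ∈ lieSeries L Γ (l + 1) :=
  Submodule.mem_sup_right (Submodule.subset_span ⟨X, hX, Y, hY, rfl⟩)

theorem lieSeries_antitone [IsManifold (𝓡 n) ∞ M] (hL : IsSpanningLieAlgebra L) (hΓ : Γ ∈ L) :
    Antitone (lieSeries L Γ) := by
  refine antitone_nat_of_succ_le fun l => ?_
  induction l with
  | zero =>
    refine sup_le ((Submodule.span_singleton_le_iff_mem _ _).2 hΓ) (Submodule.span_le.2 ?_)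
    rintro Z ⟨X, hX, Y, hY, rfl⟩
    exact hL.bracket_mem X hX Y hY
  | succ l ih =>
    refine sup_le_sup le_rfl (Submodule.span_mono ?_)
    rintro Z ⟨X, hX, Y, hY, rfl⟩
    exact ⟨X, ih hX, Y, ih hY, rfl⟩

/-- A basis of `L` adapted to the series `L_{Γ,l}`, `l ≤ k`. -/
structure SeriesBasis (L : Submodule ℝ (VField n M)) (Γ : VField n M) (k : ℕ) where
  basis : Module.Basis (Fin n) ℝ L
  stage : Fin n → ℕ
  stage_le : ∀ i, stage i ≤ k
  basis_mem : ∀ i, ∀ l ≤ stage i, (basis i : VField n M) ∈ lieSeries L Γ l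
  repr_eq_zero : ∀ l ≤ k, ∀ X : L, (X : VField n M) ∈ lieSeries L Γ l →
    ∀ i, stage i < l → basis.repr X i = 0
  le_top : ∀ l, lieSeries L Γ l ≤ L

theorem exists_seriesBasis [IsManifold (𝓡 n) ∞ M] (hL : IsSpanningLieAlgebra L) (hΓ : Γ ∈ L)
    (k : ℕ) : Nonempty (SeriesBasis L Γ k) := by
  have := hL.finite
  have hanti := lieSeries_antitone hL hΓ
  obtain ⟨b, s, hs, hb⟩ := exists_basis_adapted hL.finrank_eq k
    (fun l => (lieSeries L Γ l).comap L.subtype) (fun l m h => Submodule.comap_mono (hanti h))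
    (by simp [lieSeries])
  refine ⟨⟨b, s, hs, fun i l hl => ?_, fun l hl X hX i hi => ?_, fun l => hanti (Nat.zero_le l)⟩⟩
  · have h1 : b i ∈ Submodule.span ℝ (b '' {i | l ≤ s i}) := Submodule.subset_span ⟨i, hl, rfl⟩
    rw [hb l (hl.trans (hs i))] at h1
    exact h1
  · have h1 : X ∈ (lieSeries L Γ l).comap L.subtype := hX
    rw [← hb l hl, Module.Basis.mem_span_image] at h1
    by_contra h
    exact absurd (h1 (Finsupp.mem_support_iff.2 h)) (not_le.2 hi)

namespace SeriesBasis

variable {k : ℕ} (b : SeriesBasis L Γ k)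

theorem stage_eq {i : Fin n} (h : ¬ b.stage i < k) : b.stage i = k :=
  le_antisymm (b.stage_le i) (not_lt.1 h)

/-- The coordinate system on `Ξ` defined by an adapted basis. -/
noncomputable def coeff : FormalSum L Γ k →ₗ[ℝ] (Fin n → ℝ) where
  toFun ξ i := if h : b.stage i < k then
      (ξ.1 ⟨b.stage i, h⟩ : Module.Dual ℝ (lieSeries L Γ (b.stage i)))
        ⟨b.basis i, b.basis_mem i _ le_rfl⟩
    else ξ.2 ⟨b.basis i, b.basis_mem i _ (not_lt.1 h)⟩
  map_add' ξ η := by ext i; by_cases h : b.stage i < k <;> simp [h]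
  map_smul' c ξ := by ext i; by_cases h : b.stage i < k <;> simp [h]

theorem dual_apply {l : ℕ} (hl : l ≤ k) (ζ : Module.Dual ℝ (lieSeries L Γ l))
    (X : lieSeries L Γ l) :
    ζ X = ∑ i, if h : l ≤ b.stage i then
      b.basis.repr ⟨X, b.le_top l X.2⟩ i * ζ ⟨b.basis i, b.basis_mem i l h⟩ else 0 := by
  have h1 : X = ∑ i, if h : l ≤ b.stage i then b.basis.repr ⟨X, b.le_top l X.2⟩ i •
      (⟨b.basis i, b.basis_mem i l h⟩ : lieSeries L Γ l) else 0 := by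
    apply Subtype.ext
    have h2 := congrArg (Subtype.val : L → VField n M) (b.basis.sum_repr ⟨X, b.le_top l X.2⟩)
    refine h2.symm.trans ?_
    rw [Submodule.coe_sum, Submodule.coe_sum]
    refine Finset.sum_congr rfl fun i _ => ?_
    split_ifs with h
    · rfl
    · rw [b.repr_eq_zero l hl _ X.2 i (not_le.1 h), zero_smul]
      rfl
  conv_lhs => rw [h1, map_sum]
  refine Finset.sum_congr rfl fun i _ => ?_
  split_ifs with h
  · rw [map_smul, smul_eq_mul]
  · rw [map_zero]

/-- The expansion runs over basis fields of stage at least `l`; those of higher stage lie in the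
next space of the series, which the annihilator kills. -/
theorem stage_apply (ξ : FormalSum L Γ k) (l : Fin k) (X : lieSeries L Γ l) :
    (ξ.1 l : Module.Dual ℝ (lieSeries L Γ l)) X =
      ∑ i, if b.stage i = l then b.coeff ξ i * b.basis.repr ⟨X, b.le_top l X.2⟩ i else 0 := by
  rw [b.dual_apply l.2.le]
  refine Finset.sum_congr rfl fun i _ => ?_
  split_ifs with h1 h2 h2
  · have hl : b.stage i < k := h2 ▸ l.2
    obtain ⟨l, hlk⟩ := l
    simp only at h2
    subst h2
    simp [coeff, hl, mul_comm]
  · have h3 := (Submodule.mem_dualAnnihilator _).1 (ξ.1 l).2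
      ⟨b.basis i, b.basis_mem i l h1⟩ (b.basis_mem i (l + 1) (by omega))
    rw [h3, mul_zero]
  · omega
  · rfl

theorem last_apply (ξ : FormalSum L Γ k) (X : lieSeries L Γ k) :
    ξ.2 X =
      ∑ i, if b.stage i = k then b.coeff ξ i * b.basis.repr ⟨X, b.le_top k X.2⟩ i else 0 := by
  rw [b.dual_apply le_rfl]
  refine Finset.sum_congr rfl fun i _ => ?_
  have := b.stage_le i
  split_ifs with h1 h2 h2
  · simp [coeff, h2, mul_comm]
  · omega
  · omega
  · rfl

theorem coeff_injective : Function.Injective b.coeff := by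
  refine (injective_iff_map_eq_zero _).2 fun ξ hξ => Prod.ext (funext fun l => ?_) ?_
  · exact Subtype.ext (LinearMap.ext fun X => by rw [b.stage_apply, hξ]; simp)
  · exact LinearMap.ext fun X => by rw [b.last_apply, hξ]; simp

/-- The preimage has as component `l` the combination of dual basis vectors of stage exactly `l`. It
annihilates the next space, whose elements have no coordinates of stage `≤ l`. -/
theorem coeff_surjective : Function.Surjective b.coeff := by
  intro c
  let ζ : ∀ l, Module.Dual ℝ (lieSeries L Γ l) := fun l =>
    (∑ i, if b.stage i = l then c i • b.basis.coord i else 0) ∘ₗ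
      Submodule.inclusion (b.le_top l)
  have hζ : ∀ l X, ζ l X = ∑ i, if b.stage i = l then
      c i * b.basis.repr ⟨X, b.le_top l X.2⟩ i else 0 := by
    intro l X
    simp only [ζ, LinearMap.comp_apply, LinearMap.sum_apply]
    refine Finset.sum_congr rfl fun i _ => ?_
    split_ifs
    · rfl
    · rfl
  have hbb : ∀ i l (h : l ≤ b.stage i), b.stage i = l →
      ζ l ⟨b.basis i, b.basis_mem i l h⟩ = c i := by
    intro i l h hi
    rw [hζ, Finset.sum_eq_single i]
    · simp [hi]
    · intro j _ hj
      simp [hj.symm]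
    · simp
  refine ⟨(fun l => ⟨ζ l, (Submodule.mem_dualAnnihilator _).2 fun X hX => ?_⟩, ζ k), ?_⟩
  · rw [hζ]
    refine Finset.sum_eq_zero fun i _ => ?_
    split_ifs with hi
    · rw [b.repr_eq_zero (l + 1) l.2 ⟨X, b.le_top l X.2⟩ hX i (by omega), mul_zero]
    · rfl
  · ext i
    by_cases h : b.stage i < k
    · simpa [coeff, h] using hbb i _ le_rfl rfl
    · simpa [coeff, h] using hbb i k (not_lt.1 h) (b.stage_eq h)

/-- The coordinate system on `Ξ` defined by an adapted basis, as a linear equivalence. -/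
noncomputable def coeffEquiv : FormalSum L Γ k ≃ₗ[ℝ] (Fin n → ℝ) :=
  LinearEquiv.ofBijective b.coeff ⟨b.coeff_injective, b.coeff_surjective⟩

theorem finrank_formalSum (b : SeriesBasis L Γ k) : Module.finrank ℝ (FormalSum L Γ k) = n := by
  rw [LinearEquiv.finrank_eq b.coeffEquiv, Module.finrank_fin_fun]

/-- As `Γ` lies in the last space of the series, its coordinates of stage below `k` vanish, and only
the last summand of `Ξ` contributes. -/
theorem evalGamma_eq (hΓ : Γ ∈ L) (ξ : FormalSum L Γ k) :
    FormalSum.evalGamma hΓ ξ = ∑ i, b.coeff ξ i * b.basis.repr ⟨Γ, hΓ⟩ i := by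
  have h0 : ∀ i, b.stage i < k → b.basis.repr ⟨Γ, hΓ⟩ i = 0 := fun i hi =>
    b.repr_eq_zero k le_rfl _ (mem_lieSeries hΓ k) i hi
  rw [FormalSum.evalGamma, Finset.sum_eq_zero, zero_add, b.last_apply]
  · refine Finset.sum_congr rfl fun i _ => ?_
    split_ifs with h
    · rfl
    · rw [h0 i (lt_of_le_of_ne (b.stage_le i) h), mul_zero]
  · intro l _
    rw [b.stage_apply]
    refine Finset.sum_eq_zero fun i _ => ?_
    split_ifs with h
    · rw [h0 i (h ▸ l.2), mul_zero]
    · rfl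

theorem coeff_stage (l : Fin k) (ζ : stageAnnihilator L Γ l) {i : Fin n} (h : b.stage i ≠ l) :
    b.coeff (FormalSum.stage L Γ k l ζ) i = 0 := by
  by_cases hi : b.stage i < k
  · have hne : (⟨b.stage i, hi⟩ : Fin k) ≠ l := fun h' => h (congrArg Fin.val h')
    simp [coeff, hi, FormalSum.stage, Pi.single_eq_of_ne hne]
  · simp [coeff, hi, FormalSum.stage]

theorem coeff_last (ζ : Module.Dual ℝ (lieSeries L Γ k)) {i : Fin n} (h : b.stage i ≠ k) :
    b.coeff (FormalSum.last L Γ k ζ) i = 0 := by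
  have hi : b.stage i < k := lt_of_le_of_ne (b.stage_le i) h
  simp [coeff, hi, FormalSum.last]

end SeriesBasis

end LieSeries

/-! ### Vector fields in a chart, in coordinates of `Fin n → ℝ` -/

section Chart

variable {n : ℕ} {M : Type*} [TopologicalSpace M]

/-- The inverse of the chart `φ`, as a function of the coordinates. -/
def chartParam (φ : OpenPartialHomeomorph M (EuclideanSpace ℝ (Fin n))) (y : Fin n → ℝ) : M :=
  φ.symm (WithLp.toLp 2 y)

/-- The coordinates of the chart `φ`. -/
def chartCoord (φ : OpenPartialHomeomorph M (EuclideanSpace ℝ (Fin n))) (x : M) : Fin n → ℝ :=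
  WithLp.ofLp (φ x)

/-- The range of the coordinates of the chart `φ`. -/
def chartRange (φ : OpenPartialHomeomorph M (EuclideanSpace ℝ (Fin n))) : Set (Fin n → ℝ) :=
  {y | WithLp.toLp 2 y ∈ φ.target}

variable {φ : OpenPartialHomeomorph M (EuclideanSpace ℝ (Fin n))}

theorem continuous_ofLp_toLp :
    Continuous (WithLp.ofLp : EuclideanSpace ℝ (Fin n) → Fin n → ℝ) ∧
    Continuous (WithLp.toLp 2 : (Fin n → ℝ) → EuclideanSpace ℝ (Fin n)) :=
  ⟨(EuclideanSpace.equiv (Fin n) ℝ).continuous, (EuclideanSpace.equiv (Fin n) ℝ).symm.continuous⟩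

theorem isOpen_chartRange : IsOpen (chartRange φ) :=
  φ.open_target.preimage continuous_ofLp_toLp.2

theorem chartParam_mem {y : Fin n → ℝ} (hy : y ∈ chartRange φ) : chartParam φ y ∈ φ.source :=
  φ.map_target hy

theorem chartCoord_mem {x : M} (hx : x ∈ φ.source) : chartCoord φ x ∈ chartRange φ :=
  φ.map_source hx

theorem chartCoord_chartParam {y : Fin n → ℝ} (hy : y ∈ chartRange φ) :
    chartCoord φ (chartParam φ y) = y := by
  rw [chartCoord, chartParam, φ.right_inv hy]

theorem chartParam_chartCoord {x : M} (hx : x ∈ φ.source) :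
    chartParam φ (chartCoord φ x) = x :=
  φ.left_inv hx

theorem continuousOn_chartCoord : ContinuousOn (chartCoord φ) φ.source :=
  continuous_ofLp_toLp.1.comp_continuousOn φ.continuousOn

variable [ChartedSpace (EuclideanSpace ℝ (Fin n)) M]

/-- The components of the vector field `X` in the chart `φ`, as functions of the coordinates. -/
noncomputable def chartField (φ : OpenPartialHomeomorph M (EuclideanSpace ℝ (Fin n)))
    (X : VField n M) (y : Fin n → ℝ) : Fin n → ℝ :=
  WithLp.ofLp (componentAt φ X (chartParam φ y))

theorem chartField_add (X Y : VField n M) (y : Fin n → ℝ) :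
    chartField φ (X + Y) y = chartField φ X y + chartField φ Y y := by
  simp only [chartField, componentAt, Pi.add_apply, map_add]
  rfl

theorem chartField_smul (c : ℝ) (X : VField n M) (y : Fin n → ℝ) :
    chartField φ (c • X) y = c • chartField φ X y := by
  simp only [chartField, componentAt, Pi.smul_apply, map_smul]
  rfl

/-- The chart components at a point, as a linear map. -/
noncomputable def chartFieldLinear (φ : OpenPartialHomeomorph M (EuclideanSpace ℝ (Fin n)))
    (y : Fin n → ℝ) : VField n M →ₗ[ℝ] (Fin n → ℝ) where
  toFun X := chartField φ X y
  map_add' X Y := chartField_add X Y y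
  map_smul' c X := chartField_smul c X y

variable (hφ : φ ∈ IsManifold.maximalAtlas (𝓡 n) ∞ M)
include hφ

theorem contMDiffOn_chartParam :
    ContMDiffOn 𝓘(ℝ, Fin n → ℝ) (𝓡 n) ∞ (chartParam φ) (chartRange φ) :=
  (contMDiffOn_symm_of_mem_maximalAtlas hφ).comp
    (EuclideanSpace.equiv (Fin n) ℝ).symm.contDiff.contMDiff.contMDiffOn fun _ hy => hy

theorem contMDiffOn_chartCoord :
    ContMDiffOn (𝓡 n) 𝓘(ℝ, Fin n → ℝ) ∞ (chartCoord φ) φ.source :=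
  (EuclideanSpace.equiv (Fin n) ℝ).contDiff.contMDiff.comp_contMDiffOn
    (contMDiffOn_of_mem_maximalAtlas hφ)

theorem mdifferentiableAt_chartParam {y : Fin n → ℝ} (hy : y ∈ chartRange φ) :
    MDifferentiableAt 𝓘(ℝ, Fin n → ℝ) (𝓡 n) (chartParam φ) y :=
  ((contMDiffOn_chartParam hφ).contMDiffAt (isOpen_chartRange.mem_nhds hy)).mdifferentiableAt
    (by simp)

theorem mdifferentiableAt_chartCoord {x : M} (hx : x ∈ φ.source) :
    MDifferentiableAt (𝓡 n) 𝓘(ℝ, Fin n → ℝ) (chartCoord φ) x :=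
  ((contMDiffOn_chartCoord hφ).contMDiffAt (φ.open_source.mem_nhds hx)).mdifferentiableAt
    (by simp)

theorem chartField_eq_mfderiv {y : Fin n → ℝ} (hy : y ∈ chartRange φ) (X : VField n M) :
    chartField φ X y =
      mfderiv (𝓡 n) 𝓘(ℝ, Fin n → ℝ) (chartCoord φ) (chartParam φ y) (X (chartParam φ y)) := by
  have h1 : MDifferentiableAt (𝓡 n) (𝓡 n) φ (chartParam φ y) :=
    ((contMDiffOn_of_mem_maximalAtlas hφ).contMDiffAt
      (φ.open_source.mem_nhds (chartParam_mem hy))).mdifferentiableAt (by simp)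
  have h2 := ((EuclideanSpace.equiv (Fin n) ℝ).hasFDerivAt.hasMFDerivAt.comp
    (chartParam φ y) h1.hasMFDerivAt).mfderiv
  change _ = mfderiv (𝓡 n) 𝓘(ℝ, Fin n → ℝ) (EuclideanSpace.equiv (Fin n) ℝ ∘ φ) _ _
  rw [h2]
  rfl

theorem mfderiv_chartCoord_comp {y : Fin n → ℝ} (hy : y ∈ chartRange φ) :
    (mfderiv (𝓡 n) 𝓘(ℝ, Fin n → ℝ) (chartCoord φ) (chartParam φ y)).comp
      (mfderiv 𝓘(ℝ, Fin n → ℝ) (𝓡 n) (chartParam φ) y) =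
      ContinuousLinearMap.id ℝ (TangentSpace 𝓘(ℝ, Fin n → ℝ) y) := by
  have h := ((mdifferentiableAt_chartCoord hφ (chartParam_mem hy)).hasMFDerivAt.comp y
    (mdifferentiableAt_chartParam hφ hy).hasMFDerivAt)
  refine hasMFDerivAt_unique h ((hasMFDerivAt_id y).congr_of_eventuallyEq ?_)
  filter_upwards [isOpen_chartRange.mem_nhds hy] with z hz using chartCoord_chartParam hz

theorem mfderiv_chartParam_comp {y : Fin n → ℝ} (hy : y ∈ chartRange φ) :
    (mfderiv 𝓘(ℝ, Fin n → ℝ) (𝓡 n) (chartParam φ) y).comp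
      (mfderiv (𝓡 n) 𝓘(ℝ, Fin n → ℝ) (chartCoord φ) (chartParam φ y)) =
      ContinuousLinearMap.id ℝ (TangentSpace (𝓡 n) (chartParam φ y)) := by
  have h1 : HasMFDerivAt 𝓘(ℝ, Fin n → ℝ) (𝓡 n) (chartParam φ) (chartCoord φ (chartParam φ y))
      (mfderiv 𝓘(ℝ, Fin n → ℝ) (𝓡 n) (chartParam φ) y) := by
    rw [chartCoord_chartParam hy]
    exact (mdifferentiableAt_chartParam hφ hy).hasMFDerivAt
  have h := (h1.comp _ (mdifferentiableAt_chartCoord hφ (chartParam_mem hy)).hasMFDerivAt)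
  refine hasMFDerivAt_unique h ((hasMFDerivAt_id (chartParam φ y)).congr_of_eventuallyEq ?_)
  filter_upwards [φ.open_source.mem_nhds (chartParam_mem hy)] with z hz
    using chartParam_chartCoord hz

theorem mfderiv_chartParam_chartField {y : Fin n → ℝ} (hy : y ∈ chartRange φ) (X : VField n M) :
    mfderiv 𝓘(ℝ, Fin n → ℝ) (𝓡 n) (chartParam φ) y (chartField φ X y) = X (chartParam φ y) := by
  rw [chartField_eq_mfderiv hφ hy]
  exact DFunLike.congr_fun (mfderiv_chartParam_comp hφ hy) (X (chartParam φ y))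

theorem chartField_eq_mpullback {y : Fin n → ℝ} (hy : y ∈ chartRange φ) (X : VField n M) :
    chartField φ X y =
      VectorField.mpullback 𝓘(ℝ, Fin n → ℝ) (𝓡 n) (chartParam φ) X y := by
  rw [VectorField.mpullback_apply, ContinuousLinearMap.inverse_eq
    (mfderiv_chartParam_comp hφ hy) (mfderiv_chartCoord_comp hφ hy)]
  exact chartField_eq_mfderiv hφ hy X

theorem isInvertible_mfderiv_chartParam {y : Fin n → ℝ} (hy : y ∈ chartRange φ) :
    (mfderiv 𝓘(ℝ, Fin n → ℝ) (𝓡 n) (chartParam φ) y).IsInvertible :=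
  .of_inverse (mfderiv_chartParam_comp hφ hy) (mfderiv_chartCoord_comp hφ hy)

variable [IsManifold (𝓡 n) ∞ M]

theorem contDiffOn_chartField {X : VField n M} (hX : ContMDiff (𝓡 n) (𝓡 n).tangent ∞
    (fun x => (⟨x, X x⟩ : TangentBundle (𝓡 n) M))) :
    ContDiffOn ℝ ∞ (chartField φ X) (chartRange φ) := by
  intro y hy
  have h := ContMDiffAt.mpullback_vectorField_preimage (I := 𝓘(ℝ, Fin n → ℝ)) (m := ∞) (n := ∞)
    (hX (chartParam φ y)) ((contMDiffOn_chartParam hφ).contMDiffAt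
      (isOpen_chartRange.mem_nhds hy)) (isInvertible_mfderiv_chartParam hφ hy) (by simp)
  have h2 := contMDiffAt_vectorSpace_iff_contDiffAt.1 h
  refine (h2.congr_of_eventuallyEq ?_).contDiffWithinAt
  filter_upwards [isOpen_chartRange.mem_nhds hy] with z hz using chartField_eq_mpullback hφ hz X

/-- The components are the pull-back under `chartParam`; brackets commute with pull-backs and depend
only on germs. -/
theorem chartField_mlieBracket {X Y : VField n M}
    (hX : ContMDiff (𝓡 n) (𝓡 n).tangent ∞ (fun x => (⟨x, X x⟩ : TangentBundle (𝓡 n) M)))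
    (hY : ContMDiff (𝓡 n) (𝓡 n).tangent ∞ (fun x => (⟨x, Y x⟩ : TangentBundle (𝓡 n) M)))
    {y : Fin n → ℝ} (hy : y ∈ chartRange φ) :
    chartField φ (VectorField.mlieBracket (𝓡 n) X Y) y =
      VectorField.lieBracket ℝ (chartField φ X) (chartField φ Y) y := by
  have h2 : minSmoothness ℝ 2 ≤ (∞ : WithTop ℕ∞) := by
    rw [minSmoothness_of_isRCLikeNormedField]
    exact WithTop.coe_le_coe.2 le_top
  have : IsManifold (𝓡 n) (minSmoothness ℝ 2) M := IsManifold.of_le h2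
  have hpb : ∀ Z : VField n M, chartField φ Z =ᶠ[𝓝 y]
      VectorField.mpullback 𝓘(ℝ, Fin n → ℝ) (𝓡 n) (chartParam φ) Z := fun Z => by
    filter_upwards [isOpen_chartRange.mem_nhds hy] with z hz using chartField_eq_mpullback hφ hz Z
  rw [chartField_eq_mpullback hφ hy, VectorField.mpullback_mlieBracket (n := ∞)
    ((hX _).mdifferentiableAt (by simp)) ((hY _).mdifferentiableAt (by simp))
    ((contMDiffOn_chartParam hφ).contMDiffAt (isOpen_chartRange.mem_nhds hy)) h2,
    ← VectorField.mlieBracketWithin_univ, VectorField.mlieBracketWithin_eq_lieBracketWithin]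
  refine (congrFun VectorField.lieBracketWithin_univ y).trans ?_
  exact ((hpb X).lieBracket_vectorField_eq (hpb Y)).symm

omit [IsManifold (𝓡 n) ∞ M] in
theorem hasMFDerivAt_comp_chartCoord {g : (Fin n → ℝ) → ℝ} {x : M} (hx : x ∈ φ.source)
    (hg : DifferentiableAt ℝ g (chartCoord φ x)) :
    HasMFDerivAt (𝓡 n) 𝓘(ℝ, ℝ) (fun x => g (chartCoord φ x)) x
      ((fderiv ℝ g (chartCoord φ x)).comp
        (mfderiv (𝓡 n) 𝓘(ℝ, Fin n → ℝ) (chartCoord φ) x)) :=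
  hg.hasFDerivAt.hasMFDerivAt.comp x (mdifferentiableAt_chartCoord hφ hx).hasMFDerivAt

omit [IsManifold (𝓡 n) ∞ M] in
theorem deriv_comp_chartCoord {g : (Fin n → ℝ) → ℝ} {x : M} (hx : x ∈ φ.source)
    (hg : DifferentiableAt ℝ g (chartCoord φ x)) (X : VField n M) :
    VField.deriv X (fun x => g (chartCoord φ x)) x =
      fderiv ℝ g (chartCoord φ x) (chartField φ X (chartCoord φ x)) := by
  rw [VField.deriv, differentialAt, (hasMFDerivAt_comp_chartCoord hφ hx hg).mfderiv,
    chartField_eq_mfderiv hφ (chartCoord_mem hx), chartParam_chartCoord hx]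
  rfl

omit [IsManifold (𝓡 n) ∞ M] in
theorem hasMFDerivAt_chartParam_comp {c : ℝ → Fin n → ℝ} {t : ℝ} (hc : c t ∈ chartRange φ)
    {X : VField n M} (h : HasDerivAt c (chartField φ X (c t)) t) :
    HasMFDerivAt 𝓘(ℝ, ℝ) (𝓡 n) (fun t => chartParam φ (c t)) t
      ((1 : ℝ →L[ℝ] ℝ).smulRight (X (chartParam φ (c t)))) := by
  have h1 := (mdifferentiableAt_chartParam hφ hc).hasMFDerivAt.comp t
    h.hasFDerivAt.hasMFDerivAt
  refine h1.congr_mfderiv ?_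
  ext
  change mfderiv 𝓘(ℝ, Fin n → ℝ) (𝓡 n) (chartParam φ) (c t) ((1 : ℝ) • chartField φ X (c t)) =
    (1 : ℝ) • X (chartParam φ (c t))
  rw [one_smul, one_smul, mfderiv_chartParam_chartField hφ hc]

end Chart

/-! ### The staged frame of an adapted basis -/

section SeriesFrame

variable {n : ℕ} {M : Type*} [TopologicalSpace M] [ChartedSpace (EuclideanSpace ℝ (Fin n)) M]
  {L : Submodule ℝ (VField n M)} {Γ : VField n M} {k : ℕ}
  {φ : OpenPartialHomeomorph M (EuclideanSpace ℝ (Fin n))}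

namespace SeriesBasis

variable (b : SeriesBasis L Γ k) (φ)

/-- The matrix of the components in the chart `φ` of the basis fields. -/
noncomputable def chartMatrix (y : Fin n → ℝ) : Matrix (Fin n) (Fin n) ℝ :=
  Matrix.of fun a i => chartField φ (b.basis i) y a

/-- The coframe in the chart `φ` that is dual to the basis fields. -/
noncomputable def chartCoframe (i : Fin n) (y : Fin n → ℝ) : (Fin n → ℝ) →L[ℝ] ℝ :=
  ∑ a, (b.chartMatrix φ y)⁻¹ i a • ContinuousLinearMap.proj a

theorem chartCoframe_apply (i : Fin n) (y u : Fin n → ℝ) :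
    b.chartCoframe φ i y u = ((b.chartMatrix φ y)⁻¹.mulVec u) i := by
  simp [chartCoframe, Matrix.mulVec, dotProduct, sum_apply]

variable {φ}

theorem chartField_eq_sum (X : L) (y : Fin n → ℝ) :
    chartField φ X y = ∑ i, b.basis.repr X i • chartField φ (b.basis i) y := by
  have h := congrArg (fun Z : L => chartFieldLinear φ y Z) (b.basis.sum_repr X)
  simp only [Submodule.coe_sum, Submodule.coe_smul, map_sum, map_smul] at h
  exact h.symm

theorem chartMatrix_mulVec_repr (X : L) (y : Fin n → ℝ) :
    (b.chartMatrix φ y).mulVec (b.basis.repr X) = chartField φ X y := by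
  rw [b.chartField_eq_sum]
  ext a
  simp [chartMatrix, Matrix.mulVec, dotProduct, mul_comm]

theorem isKnown_chartMatrix (a i : Fin n) :
    IsKnown (chartComponents L φ) (chartRange φ) (fun y => b.chartMatrix φ y a i) :=
  IsKnown.base (⟨n, chartRange φ, fun y => chartField φ (b.basis i) y a⟩ : LocalFun)
    ⟨b.basis i, (b.basis i).2, a, rfl⟩

variable [IsManifold (𝓡 n) ∞ M] (hL : IsSpanningLieAlgebra L)
  (hφ : φ ∈ IsManifold.maximalAtlas (𝓡 n) ∞ M)
include hL hφ

/-- The fields of `L` span each tangent space, so this square matrix is surjective and therefore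
invertible. -/
theorem det_chartMatrix_ne_zero {y : Fin n → ℝ} (hy : y ∈ chartRange φ) :
    (b.chartMatrix φ y).det ≠ 0 := by
  have h : Function.Surjective (b.chartMatrix φ y).mulVec := by
    intro u
    obtain ⟨X, hX, hXu⟩ := hL.spans (chartParam φ y)
      (mfderiv 𝓘(ℝ, Fin n → ℝ) (𝓡 n) (chartParam φ) y u)
    refine ⟨b.basis.repr ⟨X, hX⟩, ?_⟩
    rw [b.chartMatrix_mulVec_repr, chartField_eq_mfderiv hφ hy]
    simp only [hXu]
    exact DFunLike.congr_fun (mfderiv_chartCoord_comp hφ hy) u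
  rw [Matrix.mulVec_surjective_iff_isUnit, Matrix.isUnit_iff_isUnit_det] at h
  exact h.ne_zero

/-- The inverse matrix undoes the expansion of a field of `L` in the basis. Its coframe values are
thus constants, and questions about brackets become questions about coordinates in `L`. -/
theorem chartCoframe_chartField {y : Fin n → ℝ} (hy : y ∈ chartRange φ) (X : L) (i : Fin n) :
    b.chartCoframe φ i y (chartField φ X y) = b.basis.repr X i := by
  have h := isUnit_iff_ne_zero.2 (b.det_chartMatrix_ne_zero hL hφ hy)
  rw [chartCoframe_apply, ← b.chartMatrix_mulVec_repr, Matrix.mulVec_mulVec,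
    Matrix.nonsing_inv_mul _ h, Matrix.one_mulVec]

theorem isKnown_chartCoframe (i a : Fin n) :
    IsKnown (chartComponents L φ) (chartRange φ)
      (fun y => b.chartCoframe φ i y (Pi.single a 1)) := by
  refine (IsKnown.matrix_inv isOpen_chartRange b.isKnown_chartMatrix
    (fun y hy => b.det_chartMatrix_ne_zero hL hφ hy) i a).congr isOpen_chartRange fun y _ => ?_
  simp [chartCoframe_apply]

theorem isOpen_and_contDiffOn_chartComponents :
    ∀ g ∈ chartComponents L φ, IsOpen g.dom ∧ ContDiffOn ℝ ∞ g.toFun g.dom := by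
  rintro g ⟨X, hX, i, rfl⟩
  exact ⟨isOpen_chartRange, contDiffOn_pi.1 (contDiffOn_chartField hφ (hL.smooth X hX)) i⟩

theorem contDiffOn_chartCoframe (i : Fin n) :
    ContDiffOn ℝ ∞ (b.chartCoframe φ i) (chartRange φ) := by
  have h : ∀ a, ContDiffOn ℝ ∞ (fun y => (b.chartMatrix φ y)⁻¹ i a) (chartRange φ) := fun a =>
    ((IsKnown.matrix_inv isOpen_chartRange b.isKnown_chartMatrix (fun y hy =>
      b.det_chartMatrix_ne_zero hL hφ hy) i a).isOpen_and_contDiffOn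
      (isOpen_and_contDiffOn_chartComponents hL hφ)).2
  exact ContDiffOn.sum fun a _ => (h a).smul contDiffOn_const

/-- The frame in the chart `φ` given by an adapted basis. -/
noncomputable def chartFrame (hab : IsAbelianSpace (lieSeries L Γ k)) : StagedFrame n where
  dom := chartRange φ
  isOpen_dom := isOpen_chartRange
  field i := chartField φ (b.basis i)
  coframe := b.chartCoframe φ
  stage := b.stage
  contDiffOn_field i := contDiffOn_chartField hφ (hL.smooth _ (b.basis i).2)
  contDiffOn_coframe := b.contDiffOn_chartCoframe hL hφ
  dual y hy i j := by
    rw [b.chartCoframe_chartField hL hφ hy, Module.Basis.repr_self, Finsupp.single_apply]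
    simp only [eq_comm]
  bracket y hy i j m hj hm := by
    rw [← chartField_mlieBracket hφ (hL.smooth _ (b.basis j).2) (hL.smooth _ (b.basis m).2) hy,
      b.chartCoframe_chartField hL hφ hy
        ⟨_, hL.bracket_mem _ (b.basis j).2 _ (b.basis m).2⟩]
    have hjk := b.basis_mem j _ hj
    have hmk := b.basis_mem m _ hm
    -- Below stage `k` the bracket falls into the next space of the series, which has no `i`-th
    -- coordinate; at stage `k` it is zero by commutativity.
    by_cases hi : b.stage i < k
    · exact b.repr_eq_zero (b.stage i + 1) hi _ (mlieBracket_mem_lieSeries hjk hmk) i (by omega)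
    · rw [b.stage_eq hi] at hjk hmk
      have h0 : (⟨_, hL.bracket_mem _ (b.basis j).2 _ (b.basis m).2⟩ : L) = 0 :=
        Subtype.ext (hab _ hjk _ hmk)
      rw [h0, map_zero, Finsupp.zero_apply]

/-- Such an `X` involves only basis fields of stage at least that of `i`, on which the derivative of
`Q i` is dual to the basis. -/
theorem fderiv_integral {hab : IsAbelianSpace (lieSeries L Γ k)} {l : ℕ} {U : Set (Fin n → ℝ)}
    {p : Fin n → ℝ} {Q : Fin n → (Fin n → ℝ) → ℝ}
    (h : (b.chartFrame hL hφ hab).IsIntegrals l U p Q) {i : Fin n} (hi : b.stage i < l)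
    {y : Fin n → ℝ} (hy : y ∈ U) {X : L} (hX : (X : VField n M) ∈ lieSeries L Γ (b.stage i)) :
    fderiv ℝ (Q i) y (chartField φ X y) = b.basis.repr X i := by
  rw [b.chartField_eq_sum, map_sum, Finset.sum_eq_single i]
  · have := h.deriv i hi y hy i le_rfl
    rw [map_smul]
    refine (congrArg _ this).trans (by simp)
  · intro m _ hm
    rw [map_smul]
    by_cases hmi : b.stage m < b.stage i
    · rw [b.repr_eq_zero _ (b.stage_le i) X hX m hmi, zero_smul]
    · refine (congrArg _ (h.deriv i hi y hy m (not_lt.1 hmi))).trans ?_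
      simp [hm.symm]
  · simp

end SeriesBasis

omit [ChartedSpace (EuclideanSpace ℝ (Fin n)) M] in
theorem isOpen_chartPreimage {S : Set (Fin n → ℝ)} (hS : IsOpen S) :
    IsOpen (φ.source ∩ chartCoord φ ⁻¹' S) :=
  continuousOn_chartCoord.isOpen_inter_preimage φ.open_source hS

omit [ChartedSpace (EuclideanSpace ℝ (Fin n)) M] in
theorem chartParam_mem_chartPreimage_iff {S : Set (Fin n → ℝ)} {y : Fin n → ℝ}
    (hS : S ⊆ chartRange φ) :
    (y ∈ chartRange φ ∧ chartParam φ y ∈ φ.source ∩ chartCoord φ ⁻¹' S) ↔ y ∈ S := by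
  refine ⟨fun h => ?_, fun h => ⟨hS h, chartParam_mem (hS h), ?_⟩⟩
  · have := h.2.2
    rwa [mem_preimage, chartCoord_chartParam h.1] at this
  · rwa [mem_preimage, chartCoord_chartParam (hS h)]

omit [ChartedSpace (EuclideanSpace ℝ (Fin n)) M] in
theorem IsKnown.isKnownInChart {B : Set LocalFun} {S : Set (Fin n → ℝ)} (hSo : IsOpen S)
    (hS : S ⊆ chartRange φ) {f : (Fin n → ℝ) → ℝ} (h : IsKnown B S f) :
    IsKnownInChart B φ (φ.source ∩ chartCoord φ ⁻¹' S) (fun x => f (chartCoord φ x)) := by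
  have hset : {y : Fin n → ℝ | WithLp.toLp 2 y ∈ φ.target ∧
      φ.symm (WithLp.toLp 2 y) ∈ φ.source ∩ chartCoord φ ⁻¹' S} = S := by
    ext y
    exact chartParam_mem_chartPreimage_iff hS
  rw [IsKnownInChart, hset]
  exact h.congr hSo fun y hy => congrArg f (chartCoord_chartParam (hS hy)).symm

/-- A change of coordinates in the chart `φ` gives a chart of the manifold. -/
theorem exists_mem_maximalAtlas_comp [IsManifold (𝓡 n) ∞ M]
    (hφ : φ ∈ IsManifold.maximalAtlas (𝓡 n) ∞ M)
    (e : OpenPartialHomeomorph (Fin n → ℝ) (Fin n → ℝ))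
    (he : ContDiffOn ℝ ∞ e e.source) (hsymm : ContDiffOn ℝ ∞ e.symm e.target) :
    ∃ ψ ∈ IsManifold.maximalAtlas (𝓡 n) ∞ M,
      ψ.source = φ.source ∩ chartCoord φ ⁻¹' e.source ∧
      ∀ x, ψ x = WithLp.toLp 2 (e (chartCoord φ x)) := by
  let T := (EuclideanSpace.equiv (Fin n) ℝ)
  let ψ := ((φ.trans T.toHomeomorph.toOpenPartialHomeomorph).trans e).trans
    T.symm.toHomeomorph.toOpenPartialHomeomorph
  have hsrc : ψ.source = φ.source ∩ chartCoord φ ⁻¹' e.source := by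
    ext x
    simp only [ψ, OpenPartialHomeomorph.trans_source]
    simp only [Homeomorph.toOpenPartialHomeomorph_source, preimage_univ, inter_univ]
    rfl
  refine ⟨ψ, ψ.mem_maximalAtlas_of_contMDiffOn ?_ ?_, hsrc, fun x => rfl⟩
  · rw [hsrc]
    exact T.symm.contDiff.contMDiff.comp_contMDiffOn (he.contMDiffOn.comp
      ((contMDiffOn_chartCoord hφ).mono inter_subset_left) fun x hx => hx.2)
  · have htgt : ∀ w ∈ ψ.target, T w ∈ e.target ∧ e.symm (T w) ∈ chartRange φ := by
      intro w hw
      simp [ψ] at hw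
      exact hw
    exact (contMDiffOn_chartParam hφ).comp (hsymm.contMDiffOn.comp
      T.contDiff.contMDiff.contMDiffOn fun w hw => (htgt w hw).1) fun w hw => (htgt w hw).2

end SeriesFrame

/-! ### Rectification and the flow -/

section Main

variable {n : ℕ} {M : Type*} [TopologicalSpace M] [ChartedSpace (EuclideanSpace ℝ (Fin n)) M]
  {L : Submodule ℝ (VField n M)} {Γ : VField n M} {k : ℕ}
  {φ : OpenPartialHomeomorph M (EuclideanSpace ℝ (Fin n))}

/-- A function with constant derivative along `Γ` is affine along the integral curves of `Γ`. -/
theorem IsMIntegralCurveOn.affine_of_deriv_eq {q : M → ℝ} {U : Set M} {c : ℝ}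
    (hq : ∀ x ∈ U, MDifferentiableAt (𝓡 n) 𝓘(ℝ, ℝ) q x)
    (hd : ∀ x ∈ U, VField.deriv Γ q x = c) {s : Set ℝ} {γ : ℝ → M} (hs : s.OrdConnected)
    (hγ : IsMIntegralCurveOn γ Γ s) (hU : MapsTo γ s U) {t₀ t : ℝ} (ht₀ : t₀ ∈ s) (ht : t ∈ s) :
    q (γ t) = q (γ t₀) + c * (t - t₀) := by
  have h1 : ∀ t ∈ s, HasDerivWithinAt (fun t => q (γ t) - c * t) 0 s t := by
    intro t ht
    have h2 := ((hq _ (hU ht)).hasMFDerivAt.comp_hasMFDerivWithinAt t (hγ t ht))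
    let D : ℝ →L[ℝ] ℝ := (mfderiv (𝓡 n) 𝓘(ℝ, ℝ) q (γ t)).comp
      ((1 : ℝ →L[ℝ] ℝ).smulRight (Γ (γ t)))
    have h3 : HasFDerivWithinAt (fun t => q (γ t)) D s t :=
      hasMFDerivWithinAt_iff_hasFDerivWithinAt.1 h2
    have h4 : D 1 = c := by
      change mfderiv (𝓡 n) 𝓘(ℝ, ℝ) q (γ t) ((1 : ℝ) • Γ (γ t)) = c
      rw [one_smul]
      exact hd _ (hU ht)
    have h5 := h3.hasDerivWithinAt.fun_sub ((hasDerivWithinAt_id t s).const_mul c)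
    rw [h4] at h5
    simpa using h5
  -- The mean value inequality with constant `0` on a convex set also covers intervals containing
  -- their endpoints.
  have h2 := hs.convex.norm_image_sub_le_of_norm_hasDerivWithin_le (C := 0) h1 (by simp) ht₀ ht
  rw [zero_mul, norm_le_zero_iff] at h2
  linarith

theorem fderiv_linearCombination {e : (Fin n → ℝ) → (Fin n → ℝ)} {y : Fin n → ℝ}
    (he : DifferentiableAt ℝ e y) (c u : Fin n → ℝ) :
    fderiv ℝ (fun y => ∑ i, c i * e y i) y u = ∑ i, c i * fderiv ℝ e y u i := by
  have h := HasFDerivAt.fun_sum (u := Finset.univ) fun i _ =>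
    (hasFDerivAt_pi'.1 he.hasFDerivAt i).const_mul (c i)
  rw [h.fderiv, sum_apply]
  rfl

/-- In the coordinates `e` the field is the constant `c`, so the flow is `e.symm (e y + t • c)`: a
substitution into known functions. -/
theorem isLocalFlow_and_known_of_rectified
    (hφ : φ ∈ IsManifold.maximalAtlas (𝓡 n) ∞ M)
    {e : OpenPartialHomeomorph (Fin n → ℝ) (Fin n → ℝ)} (hedom : e.source ⊆ chartRange φ)
    (he : ContDiffOn ℝ ∞ e e.source) (hsymm : ContDiffOn ℝ ∞ e.symm e.target)
    {r : ℝ} (hr : 0 < r) (het : e.target = Metric.ball 0 r) {c : Fin n → ℝ}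
    (hc : ∀ y ∈ e.source, fderiv ℝ e y (chartField φ Γ y) = c) {p : M} (hp : p ∈ φ.source)
    (hpe : chartCoord φ p ∈ e.source) (hp0 : e (chartCoord φ p) = 0) {B : Set LocalFun}
    (hek : ∀ i, IsKnown B e.source fun y => e y i)
    (hsk : ∀ i, IsKnown B e.target fun w => e.symm w i) :
    ∃ (V : Set M) (ε : ℝ) (Φ : ℝ → M → M),
      IsOpen V ∧ p ∈ V ∧ V ⊆ φ.source ∩ chartCoord φ ⁻¹' e.source ∧ 0 < ε ∧
      IsLocalFlow Γ (φ.source ∩ chartCoord φ ⁻¹' e.source) V ε Φ ∧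
      FlowIsKnownInChart B φ V ε Φ := by
  let W : Set (Fin n → ℝ) := e.source ∩ e ⁻¹' Metric.ball 0 (r / 2)
  have hW : IsOpen W := e.isOpen_inter_preimage Metric.isOpen_ball
  have hWdom : W ⊆ chartRange φ := inter_subset_left.trans hedom
  -- Points start in the half ball and may move by at most `r / 2`; the summand `1` covers `c = 0`.
  let ε : ℝ := r / 2 / (‖c‖ + 1)
  have hε : 0 < ε := by positivity
  have hmem : ∀ y ∈ W, ∀ t ∈ Ioo (-ε) ε, e y + t • c ∈ e.target := by
    intro y hy t ht
    have h1 : ‖e y‖ < r / 2 := mem_ball_zero_iff.1 hy.2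
    have h2 : ‖t • c‖ ≤ r / 2 := by
      rw [norm_smul, Real.norm_eq_abs]
      have h3 : |t| ≤ ε := (abs_lt.2 ht).le
      calc |t| * ‖c‖ ≤ ε * (‖c‖ + 1) := by gcongr; linarith
        _ = r / 2 := by simp only [ε]; field_simp
    rw [het, mem_ball_zero_iff]
    linarith [norm_add_le (e y) (t • c)]
  let Φ : ℝ → M → M := fun t x => chartParam φ (e.symm (e (chartCoord φ x) + t • c))
  refine ⟨φ.source ∩ chartCoord φ ⁻¹' W, ε, Φ, isOpen_chartPreimage hW, ⟨hp, hpe, ?_⟩,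
    fun x hx => ⟨hx.1, hx.2.1⟩, hε, fun x hx => ⟨?_, fun t ht => ?_, fun t ht => ?_⟩, fun i => ?_⟩
  · rw [mem_preimage, hp0]
    exact Metric.mem_ball_self (by positivity)
  · simp only [Φ, zero_smul, add_zero]
    rw [e.left_inv hx.2.1, chartParam_chartCoord hx.1]
  · have hw := hmem _ hx.2 t ht
    have hy := e.map_target hw
    refine (hasMFDerivAt_chartParam_comp hφ (hedom hy) ?_).hasMFDerivWithinAt
    have h1 : HasDerivAt (fun t : ℝ => e (chartCoord φ x) + t • c) c t := by
      simpa using ((hasDerivAt_id t).smul_const c).const_add (e (chartCoord φ x))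
    have h2 := (((hsymm.contDiffAt (e.open_target.mem_nhds hw)).differentiableAt
      (by simp)).hasFDerivAt.comp_hasDerivAt t h1)
    refine h2.congr_deriv ?_
    have h3 := e.fderiv_symm_fderiv he hsymm hy (chartField φ Γ (e.symm (e (chartCoord φ x) + t • c)))
    rwa [hc _ hy, e.right_inv hw] at h3
  · have hy := e.map_target (hmem _ hx.2 t ht)
    refine ⟨chartParam_mem (hedom hy), ?_⟩
    rwa [mem_preimage, chartCoord_chartParam (hedom hy)]
  · let ρ : (Fin (n + 1) → ℝ) → (Fin n → ℝ) := fun z j => z j.castSucc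
    have hρ : Continuous ρ := by fun_prop
    let S : Set (Fin (n + 1) → ℝ) := {z | z (Fin.last n) ∈ Ioo (-ε) ε ∧ ρ z ∈ W}
    have hS : IsOpen S :=
      (isOpen_Ioo.preimage (continuous_apply (Fin.last n))).inter (hW.preimage hρ)
    have hset : {z : Fin (n + 1) → ℝ | z (Fin.last n) ∈ Ioo (-ε) ε ∧
        WithLp.toLp 2 (fun j : Fin n => z j.castSucc) ∈ φ.target ∧
        φ.symm (WithLp.toLp 2 (fun j : Fin n => z j.castSucc)) ∈
          φ.source ∩ chartCoord φ ⁻¹' W} = S := by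
      ext z
      exact and_congr_right fun _ => chartParam_mem_chartPreimage_iff (y := ρ z) hWdom
    rw [hset]
    refine ((hsk i).comp (g := fun j z => e (ρ z) j + z (Fin.last n) * c j) hS (fun j => ?_)
      fun z hz => hmem _ hz.2 _ hz.1).congr hS fun z hz => ?_
    · exact ((hek j).comp hS (fun a => .coord S hS _) fun z hz => hz.2.1).add
        ((IsKnown.coord S hS _).mul (.const S hS _))
    · have hz' := hedom (e.map_target (hmem _ hz.2 _ hz.1))
      change e.symm (e (ρ z) + z (Fin.last n) • c) i = chartCoord φ (chartParam φ
        (e.symm (e (chartCoord φ (chartParam φ (ρ z))) + z (Fin.last n) • c))) i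
      rw [chartCoord_chartParam (hWdom hz.2), chartCoord_chartParam hz']

variable [IsManifold (𝓡 n) ∞ M]

/-- Coordinates adapted to the series `L_{Γ,l}`, obtained by successive quadratures. -/
theorem SeriesBasis.exists_rectifying_coordinates (b : SeriesBasis L Γ k)
    (hL : IsSpanningLieAlgebra L) (hφ : φ ∈ IsManifold.maximalAtlas (𝓡 n) ∞ M)
    (hab : IsAbelianSpace (lieSeries L Γ k)) {p : Fin n → ℝ} (hp : p ∈ chartRange φ) :
    ∃ (F : ℕ → LocalFun) (e : OpenPartialHomeomorph (Fin n → ℝ) (Fin n → ℝ)) (r : ℝ),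
      (∀ j < k + 1, IsQuadrature (chartComponents L φ ∪ F '' Iio j) (F j)) ∧
      0 < r ∧ p ∈ e.source ∧ e.source ⊆ chartRange φ ∧ e p = 0 ∧ e.target = Metric.ball 0 r ∧
      ContDiffOn ℝ ∞ e e.source ∧ ContDiffOn ℝ ∞ e.symm e.target ∧
      (∀ i, IsKnown (chartComponents L φ ∪ F '' Iic (b.stage i)) e.source fun y => e y i) ∧
      (∀ i, IsKnown (chartComponents L φ ∪ F '' Iic k) e.target fun w => e.symm w i) ∧
      ∀ i, ∀ X : L, (X : VField n M) ∈ lieSeries L Γ (b.stage i) → ∀ y ∈ e.source,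
        fderiv ℝ e y (chartField φ X y) i = b.basis.repr X i := by
  let R := b.chartFrame hL hφ hab
  obtain ⟨F, U, Q, hF, h, hQ⟩ := R.exists_integrals (B := chartComponents L φ)
    (b.isKnown_chartCoframe hL hφ) hp (k + 1)
  -- After `k + 1` stages every coordinate is an integral and no filler coordinate is left.
  have hst : ∀ i, R.stage i < k + 1 := fun i => Nat.lt_succ_of_le (b.stage_le i)
  obtain ⟨e, r, hr, he, hpe, heU, het, hsymm, hdet⟩ := h.exists_chart
  have heQ : ∀ y i, e y i = Q i y := fun y i => by
    rw [he, StagedFrame.adapted, if_pos (hst i)]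
  have hsm : ContDiffOn ℝ ∞ e e.source := he ▸ h.contDiffOn_adapted.mono heU
  have hek : ∀ i, IsKnown (chartComponents L φ ∪ F '' Iic (b.stage i)) e.source
      fun y => e y i := fun i =>
    ((hQ i (hst i)).mono_set e.open_source heU).congr e.open_source fun y _ => (heQ y i).symm
  refine ⟨F, e, r, hF, hr, hpe, heU.trans h.subset, ?_, het, hsm, hsymm, hek,
    IsKnown.localInverse e (fun i => (hek i).mono (union_subset_union_right _
      (image_mono (Iic_subset_Iic.2 (b.stage_le i))))) hsm hsymm hdet, fun i X hX y hy => ?_⟩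
  · rw [he, h.adapted_self]
  · rw [he, h.fderiv_adapted (heU hy), if_pos (hst i),
      b.fderiv_integral hL hφ h (hst i) (heU hy) hX]

end Main

/-! ### Linear combinations of the rectifying coordinates on the manifold -/

section Rectifying

variable {n : ℕ} {M : Type*} [TopologicalSpace M] [ChartedSpace (EuclideanSpace ℝ (Fin n)) M]
  {φ : OpenPartialHomeomorph M (EuclideanSpace ℝ (Fin n))}
  {e : OpenPartialHomeomorph (Fin n → ℝ) (Fin n → ℝ)}

/-- The linear combination, with coefficients `c`, of the coordinates `e` composed with `φ`. -/
noncomputable def coordCombination (φ : OpenPartialHomeomorph M (EuclideanSpace ℝ (Fin n)))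
    (e : (Fin n → ℝ) → (Fin n → ℝ)) : (Fin n → ℝ) →ₗ[ℝ] (M → ℝ) where
  toFun c x := ∑ i, c i * e (chartCoord φ x) i
  map_add' c d := by ext x; simp [add_mul, Finset.sum_add_distrib]
  map_smul' a c := by ext x; simp [Finset.mul_sum, mul_assoc]

variable (hφ : φ ∈ IsManifold.maximalAtlas (𝓡 n) ∞ M) (hedom : e.source ⊆ chartRange φ)
  (he : ContDiffOn ℝ ∞ e e.source)
include hφ he

theorem contMDiffOn_coordCombination (c : Fin n → ℝ) :
    ContMDiffOn (𝓡 n) 𝓘(ℝ, ℝ) ∞ (coordCombination φ e c)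
      (φ.source ∩ chartCoord φ ⁻¹' e.source) := by
  have h : ContDiffOn ℝ ∞ (fun y => ∑ i, c i * e y i) e.source :=
    ContDiffOn.sum fun i _ => contDiffOn_const.mul (contDiffOn_pi.1 he i)
  exact h.contMDiffOn.comp ((contMDiffOn_chartCoord hφ).mono inter_subset_left) fun x hx => hx.2

theorem hasMFDerivAt_coordCombination (c : Fin n → ℝ) {x : M}
    (hx : x ∈ φ.source ∩ chartCoord φ ⁻¹' e.source) :
    HasMFDerivAt (𝓡 n) 𝓘(ℝ, ℝ) (coordCombination φ e c) x
      ((fderiv ℝ (fun y => ∑ i, c i * e y i) (chartCoord φ x)).comp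
        (mfderiv (𝓡 n) 𝓘(ℝ, Fin n → ℝ) (chartCoord φ) x)) := by
  have h : DifferentiableAt ℝ e (chartCoord φ x) :=
    (he.contDiffAt (e.open_source.mem_nhds hx.2)).differentiableAt (by simp)
  exact hasMFDerivAt_comp_chartCoord (g := fun y => ∑ i, c i * e y i) hφ hx.1
    (DifferentiableAt.fun_sum fun i _ => (differentiableAt_pi.1 h i).const_mul (c i))

theorem deriv_coordCombination (c : Fin n → ℝ) {x : M}
    (hx : x ∈ φ.source ∩ chartCoord φ ⁻¹' e.source) (X : VField n M) :
    VField.deriv X (coordCombination φ e c) x =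
      ∑ i, c i * fderiv ℝ e (chartCoord φ x) (chartField φ X (chartCoord φ x)) i := by
  have h : DifferentiableAt ℝ e (chartCoord φ x) :=
    (he.contDiffAt (e.open_source.mem_nhds hx.2)).differentiableAt (by simp)
  have h1 := deriv_comp_chartCoord (g := fun y => ∑ i, c i * e y i) hφ hx.1
    (DifferentiableAt.fun_sum fun i _ => (differentiableAt_pi.1 h i).const_mul (c i)) X
  rw [fderiv_linearCombination h] at h1
  exact h1

theorem differentialAt_coordCombination_linear {x : M}
    (hx : x ∈ φ.source ∩ chartCoord φ ⁻¹' e.source) :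
    ∃ D : (Fin n → ℝ) →ₗ[ℝ] (TangentSpace (𝓡 n) x →L[ℝ] ℝ),
      ∀ c, D c = differentialAt (n := n) (coordCombination φ e c) x := by
  have h : DifferentiableAt ℝ e (chartCoord φ x) :=
    (he.contDiffAt (e.open_source.mem_nhds hx.2)).differentiableAt (by simp)
  have key : ∀ c, ∀ v : TangentSpace (𝓡 n) x,
      differentialAt (n := n) (coordCombination φ e c) x v =
      ∑ i, c i * fderiv ℝ e (chartCoord φ x)
        (mfderiv (𝓡 n) 𝓘(ℝ, Fin n → ℝ) (chartCoord φ) x v) i := by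
    intro c v
    rw [differentialAt, (hasMFDerivAt_coordCombination hφ he c hx).mfderiv]
    exact fderiv_linearCombination h c _
  refine ⟨{ toFun := fun c => differentialAt (n := n) (coordCombination φ e c) x
            map_add' := fun c d => ?_
            map_smul' := fun a c => ?_ }, fun c => rfl⟩
  · ext v
    rw [add_apply]
    simp only [key, Pi.add_apply, add_mul, Finset.sum_add_distrib]
  · ext v
    rw [smul_apply]
    simp only [key, Pi.smul_apply, smul_eq_mul, RingHom.id_apply, Finset.mul_sum, mul_assoc]

include hedom in
-- Testing the differential on the `i`-th coordinate vector field of the chart `e ∘ chartCoord φ`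
-- returns `c i`.
theorem differentialAt_coordCombination_injective (hsymm : ContDiffOn ℝ ∞ e.symm e.target)
    {c : Fin n → ℝ} {x : M} (hx : x ∈ φ.source ∩ chartCoord φ ⁻¹' e.source)
    (h0 : differentialAt (n := n) (coordCombination φ e c) x = 0) : c = 0 := by
  have h : DifferentiableAt ℝ e (chartCoord φ x) :=
    (he.contDiffAt (e.open_source.mem_nhds hx.2)).differentiableAt (by simp)
  obtain ⟨y, hy, rfl⟩ : ∃ y ∈ e.source, chartParam φ y = x :=
    ⟨chartCoord φ x, hx.2, chartParam_chartCoord hx.1⟩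
  ext i
  have h1 := DFunLike.congr_fun (mfderiv_chartCoord_comp hφ (hedom hy))
    (fderiv ℝ e.symm (e y) (Pi.single i 1))
  have h2 := DFunLike.congr_fun h0 (mfderiv 𝓘(ℝ, Fin n → ℝ) (𝓡 n) (chartParam φ) y
    (fderiv ℝ e.symm (e y) (Pi.single i 1)))
  rw [differentialAt, (hasMFDerivAt_coordCombination hφ he c hx).mfderiv] at h2
  have h3 := (fderiv_linearCombination h c (mfderiv (𝓡 n) 𝓘(ℝ, Fin n → ℝ) (chartCoord φ)
    (chartParam φ y) (mfderiv 𝓘(ℝ, Fin n → ℝ) (𝓡 n) (chartParam φ) y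
      (fderiv ℝ e.symm (e y) (Pi.single i 1))))).symm.trans h2
  have h4 : mfderiv (𝓡 n) 𝓘(ℝ, Fin n → ℝ) (chartCoord φ) (chartParam φ y)
      (mfderiv 𝓘(ℝ, Fin n → ℝ) (𝓡 n) (chartParam φ) y
        (fderiv ℝ e.symm (e y) (Pi.single i 1))) = fderiv ℝ e.symm (e y) (Pi.single i 1) := h1
  rw [h4, chartCoord_chartParam (hedom hy)] at h3
  have h5 := e.fderiv_fderiv_symm he hsymm (e.map_source hy) (Pi.single i 1)
  rw [e.left_inv hy] at h5
  rw [h5] at h3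
  simpa [Pi.single_apply] using h3

include hedom in
theorem linearIndependent_differentialAt (hsymm : ContDiffOn ℝ ∞ e.symm e.target)
    {V : Type*} [AddCommMonoid V] [Module ℝ V] {C : V →ₗ[ℝ] (Fin n → ℝ)}
    (hC : Function.Injective C) (bs : Module.Basis (Fin n) ℝ V) {x : M}
    (hx : x ∈ φ.source ∩ chartCoord φ ⁻¹' e.source) :
    LinearIndependent ℝ
      (fun j => differentialAt (n := n) (coordCombination φ e (C (bs j))) x) := by
  obtain ⟨D, hD⟩ := differentialAt_coordCombination_linear hφ he hx
  have hDinj : Function.Injective D := (injective_iff_map_eq_zero D).2 fun c hc =>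
    differentialAt_coordCombination_injective hφ hedom he hsymm hx ((hD c).symm.trans hc)
  simp only [← hD]
  exact bs.linearIndependent.map_injOn (D ∘ₗ C) (hDinj.comp hC).injOn

theorem exists_chart_coordCombination [IsManifold (𝓡 n) ∞ M]
    (hsymm : ContDiffOn ℝ ∞ e.symm e.target)
    {V : Type*} [AddCommMonoid V] [Module ℝ V] {C : V →ₗ[ℝ] (Fin n → ℝ)}
    (hC : Function.Surjective C) (bs : Module.Basis (Fin n) ℝ V) :
    ∃ ψ ∈ IsManifold.maximalAtlas (𝓡 n) ∞ M,
      ψ.source = φ.source ∩ chartCoord φ ⁻¹' e.source ∧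
      ∀ x ∈ φ.source ∩ chartCoord φ ⁻¹' e.source, ∀ j,
        ψ x j = coordCombination φ e (C (bs j)) x := by
  let Λ₀ : (Fin n → ℝ) →ₗ[ℝ] (Fin n → ℝ) :=
    LinearMap.pi fun j => ∑ i, C (bs j) i • LinearMap.proj i
  have hΛ₀ : ∀ c j, Λ₀ c j = ∑ i, C (bs j) i * c i := fun c j => by
    simp [Λ₀]
  -- A vector `c` in the kernel gives a functional `ξ ↦ ∑ i, C ξ i * c i` that vanishes on the
  -- basis, hence everywhere; surjectivity of `C` then forces `c = 0`.
  have hinj : Function.Injective Λ₀ := by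
    refine (injective_iff_map_eq_zero _).2 fun c hc => ?_
    let f : V →ₗ[ℝ] ℝ := (∑ i, c i • LinearMap.proj i) ∘ₗ C
    have hf : ∀ ξ, f ξ = ∑ i, C ξ i * c i := fun ξ => by
      simp [f, mul_comm]
    have hf0 : f = 0 := bs.ext fun j => by
      rw [hf, ← hΛ₀, hc]
      rfl
    ext i
    obtain ⟨ξ, hξ⟩ := hC (Pi.single i 1)
    have := hf ξ
    rw [hf0, hξ] at this
    simpa [Pi.single_apply] using this.symm
  let Λ : (Fin n → ℝ) ≃L[ℝ] (Fin n → ℝ) :=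
    (LinearEquiv.ofInjectiveEndo Λ₀ hinj).toContinuousLinearEquiv
  obtain ⟨ψ, hψ, hsrc, hψx⟩ := exists_mem_maximalAtlas_comp hφ
    (e.trans Λ.toHomeomorph.toOpenPartialHomeomorph)
    (Λ.contDiff.comp_contDiffOn (he.mono fun y hy => hy.1))
    (hsymm.comp Λ.symm.contDiff.contDiffOn fun w hw => hw.2)
  refine ⟨ψ, hψ, ?_, fun x _ j => ?_⟩
  · rw [hsrc]
    congr 2
    ext y
    simp
  · rw [hψx]
    exact hΛ₀ _ j

end Rectifying

/-! ### Assembly of the theorem -/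

section FinImage

variable {k : ℕ} {α : Type*} (F : ℕ → α)

theorem image_val_Iio (j : Fin (k + 1)) :
    (fun i : Fin (k + 1) => F i) '' Iio j = F '' Iio (j : ℕ) := by
  ext x
  constructor
  · rintro ⟨i, hi, rfl⟩
    exact ⟨i, hi, rfl⟩
  · rintro ⟨i, hi, rfl⟩
    exact ⟨⟨i, (mem_Iio.1 hi).trans j.2⟩, hi, rfl⟩

theorem image_Iic_subset (j : Fin (k + 1)) :
    F '' Iic (j : ℕ) ⊆ (fun i : Fin (k + 1) => F i) '' Iic j := by
  rintro _ ⟨i, hi, rfl⟩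
  exact ⟨⟨i, (mem_Iic.1 hi).trans_lt j.2⟩, hi, rfl⟩

end FinImage

set_option maxHeartbeats 1000000 in
theorem mainTheorem2 {n : ℕ} {M : Type*} [TopologicalSpace M] [T2Space M]
    [ChartedSpace (EuclideanSpace ℝ (Fin n)) M] [IsManifold (𝓡 n) ∞ M]
    (L : Submodule ℝ (VField n M)) (hL : IsSpanningLieAlgebra L)
    (Γ : VField n M) (hΓ : Γ ∈ L) (k : ℕ) (hk : IsLieIntegrableOfOrder L Γ (k + 1))
    (φ : OpenPartialHomeomorph M (EuclideanSpace ℝ (Fin n)))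
    (hφ : φ ∈ IsManifold.maximalAtlas (𝓡 n) ∞ M) (p : M) (hp : p ∈ φ.source) :
    -- the space `Ξ` has dimension `n`
    Module.finrank ℝ (FormalSum L Γ k) = n ∧
    -- `k + 1` quadratures `F`, a neighbourhood `U` of `p`, and functions `Q ξ` linear in `ξ`
    ∃ (F : Fin (k + 1) → LocalFun) (U : Set M) (Q : FormalSum L Γ k →ₗ[ℝ] (M → ℝ)),
      IsQuadratureSequence (chartComponents L φ) F ∧
      IsOpen U ∧ p ∈ U ∧ U ⊆ φ.source ∧
      (∀ ξ, ContMDiffOn (𝓡 n) 𝓘(ℝ, ℝ) ∞ (Q ξ) U) ∧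
      -- the functions of stage `l` are obtained with the first `l + 1` quadratures and solve
      -- the equations `X Q = ζ(X)` for `X ∈ L_{Γ,l}`
      (∀ (l : Fin k) (ζ : stageAnnihilator L Γ l),
        IsKnownInChart (chartComponents L φ ∪ F '' Iic l.castSucc) φ U
          (Q (FormalSum.stage L Γ k l ζ)) ∧
        ∀ X : lieSeries L Γ l, ∀ x ∈ U,
          VField.deriv (X : VField n M) (Q (FormalSum.stage L Γ k l ζ)) x =
            (ζ : Module.Dual ℝ (lieSeries L Γ l)) X) ∧
      (∀ ζ : Module.Dual ℝ (lieSeries L Γ k), ∀ X : lieSeries L Γ k, ∀ x ∈ U,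
        VField.deriv (X : VField n M) (Q (FormalSum.last L Γ k ζ)) x = ζ X) ∧
      -- all the functions `Q ξ` are obtained by the `k + 1` quadratures
      (∀ ξ, IsKnownInChart (chartComponents L φ ∪ range F) φ U (Q ξ)) ∧
      -- `Γ Q_ξ` is the constant `ξ(Γ)`
      (∀ ξ, ∀ x ∈ U, VField.deriv Γ (Q ξ) x = FormalSum.evalGamma hΓ ξ) ∧
      -- functional independence: each basis of `Ξ` gives local coordinates on `U`
      (∀ b : Module.Basis (Fin n) ℝ (FormalSum L Γ k),
        (∀ x ∈ U, LinearIndependent ℝ (fun j => differentialAt (n := n) (Q (b j)) x)) ∧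
        ∃ ψ ∈ IsManifold.maximalAtlas (𝓡 n) ∞ M, ψ.source = U ∧
          ∀ x ∈ U, ∀ j, ψ x j = Q (b j) x) ∧
      -- the flow is rectified: along integral curves in `U`, `Q ξ` is affine with slope `ξ(Γ)`
      (∀ (s : Set ℝ) (γ : ℝ → M), s.OrdConnected → IsMIntegralCurveOn γ Γ s → MapsTo γ s U →
        ∀ ξ, ∀ t₀ ∈ s, ∀ t ∈ s,
          Q ξ (γ t) = Q ξ (γ t₀) + FormalSum.evalGamma hΓ ξ * (t - t₀)) ∧
      -- the integral curves of `Γ` are obtained by the `k + 1` quadratures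
      ∃ (V : Set M) (ε : ℝ) (Φ : ℝ → M → M),
        IsOpen V ∧ p ∈ V ∧ V ⊆ U ∧ 0 < ε ∧ IsLocalFlow Γ U V ε Φ ∧
        FlowIsKnownInChart (chartComponents L φ ∪ range F) φ V ε Φ := by
  obtain ⟨k', hk', hab, -⟩ := hk
  obtain rfl : k = k' := by omega
  obtain ⟨b⟩ := exists_seriesBasis hL hΓ k
  refine ⟨b.finrank_formalSum, ?_⟩
  obtain ⟨F, e, r, hF, hr, hpe, hedom, hp0, het, he, hsymm, hek, hsk, hd⟩ :=
    b.exists_rectifying_coordinates hL hφ hab (chartCoord_mem hp)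
  have hrange : F '' Iic k ⊆ range fun i : Fin (k + 1) => F i :=
    (image_Iic_subset F (Fin.last k)).trans (image_subset_range _ _)
  have hek' : ∀ i, IsKnown (chartComponents L φ ∪ range fun i : Fin (k + 1) => F i) e.source
      fun y => e y i := fun i => (hek i).mono (union_subset_union_right _
    ((image_mono (Iic_subset_Iic.2 (b.stage_le i))).trans hrange))
  let Q : FormalSum L Γ k →ₗ[ℝ] (M → ℝ) := coordCombination φ e ∘ₗ b.coeff
  -- Membership is asked only for indices that occur in `ξ`: a summand of stage `l` then needs only
  -- `X` in the `l`-th space, while `Γ` is admissible for every `ξ`.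
  have hderiv : ∀ ξ, ∀ x ∈ φ.source ∩ chartCoord φ ⁻¹' e.source, ∀ X : L,
      (∀ i, b.coeff ξ i ≠ 0 → (X : VField n M) ∈ lieSeries L Γ (b.stage i)) →
      VField.deriv (X : VField n M) (Q ξ) x = ∑ i, b.coeff ξ i * b.basis.repr X i := by
    intro ξ x hx X hX
    refine (deriv_coordCombination hφ he (b.coeff ξ) hx X).trans
      (Finset.sum_congr rfl fun i _ => ?_)
    by_cases hi : b.coeff ξ i = 0
    · rw [hi, zero_mul, zero_mul]
    · rw [hd i X (hX i hi) _ hx.2]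
  have hderivΓ : ∀ ξ, ∀ x ∈ φ.source ∩ chartCoord φ ⁻¹' e.source,
      VField.deriv Γ (Q ξ) x = FormalSum.evalGamma hΓ ξ := fun ξ x hx => by
    rw [b.evalGamma_eq hΓ]
    exact hderiv ξ x hx ⟨Γ, hΓ⟩ fun i _ => mem_lieSeries hΓ _
  have hknown : ∀ (B : Set LocalFun) (c : Fin n → ℝ), (∀ i, c i ≠ 0 →
      IsKnown B e.source fun y => e y i) →
      IsKnownInChart B φ (φ.source ∩ chartCoord φ ⁻¹' e.source) (coordCombination φ e c) := by
    intro B c hc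
    refine IsKnown.isKnownInChart (f := fun y => ∑ i, c i * e y i) e.open_source hedom
      (.sum e.open_source _ fun i _ => ?_)
    by_cases hi : c i = 0
    · simpa [hi] using IsKnown.const (B := B) e.source e.open_source 0
    · exact (hc i hi).const_mul e.open_source _
  refine ⟨fun i => F i, φ.source ∩ chartCoord φ ⁻¹' e.source, Q, fun j => ?_,
    isOpen_chartPreimage e.open_source, ⟨hp, hpe⟩, inter_subset_left,
    fun ξ => contMDiffOn_coordCombination hφ he _, fun l ζ => ⟨?_, fun X x hx => ?_⟩,
    fun ζ X x hx => ?_, fun ξ => hknown _ _ fun i _ => hek' i, hderivΓ, fun bs => ⟨?_, ?_⟩,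
    fun s γ hs hγ hU ξ t₀ ht₀ t ht => ?_, ?_⟩
  · rw [image_val_Iio]
    exact hF j j.2
  · refine hknown _ _ fun i hi => (hek i).mono (union_subset_union_right _ ?_)
    -- A nonzero coefficient forces the index to have stage exactly `l`.
    rw [not_ne_iff.1 (mt (b.coeff_stage l ζ) hi)]
    exact image_Iic_subset F l.castSucc
  · have h1 := b.stage_apply (FormalSum.stage L Γ k l ζ) l X
    have h2 : (FormalSum.stage L Γ k l ζ).1 l = ζ := by simp [FormalSum.stage]
    rw [h2] at h1
    rw [h1, hderiv _ x hx ⟨X, b.le_top l X.2⟩ fun i hi => by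
      rw [not_ne_iff.1 (mt (b.coeff_stage l ζ) hi)]; exact X.2]
    refine Finset.sum_congr rfl fun i _ => ?_
    split_ifs with hi
    · rfl
    · rw [b.coeff_stage l ζ hi, zero_mul]
  · have h1 := b.last_apply (FormalSum.last L Γ k ζ) X
    have h2 : (FormalSum.last L Γ k ζ).2 = ζ := by simp [FormalSum.last]
    rw [h2] at h1
    rw [h1, hderiv _ x hx ⟨X, b.le_top k X.2⟩ fun i hi => by
      rw [not_ne_iff.1 (mt (b.coeff_last ζ) hi)]; exact X.2]
    refine Finset.sum_congr rfl fun i _ => ?_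
    split_ifs with hi
    · rfl
    · rw [b.coeff_last ζ hi, zero_mul]
  · intro x hx
    exact linearIndependent_differentialAt (C := b.coeff) hφ hedom he hsymm
      b.coeff_injective bs hx
  · exact exists_chart_coordCombination (C := b.coeff) hφ he hsymm b.coeff_surjective bs
  · exact IsMIntegralCurveOn.affine_of_deriv_eq
      (fun x hx => (hasMFDerivAt_coordCombination hφ he _ hx).mdifferentiableAt)
      (hderivΓ ξ) hs hγ hU ht₀ ht
  · exact isLocalFlow_and_known_of_rectified hφ hedom he hsymm hr het
      (c := b.basis.repr ⟨Γ, hΓ⟩)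
      (fun y hy => funext fun i => hd i ⟨Γ, hΓ⟩ (mem_lieSeries hΓ _) y hy) hp hpe hp0 hek'
      fun i => (hsk i).mono (union_subset_union_right _ hrange)
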